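/- Let $M$ be a smooth manifold of dimension $n$ without boundary, and let $F:TM\to[0,\infty)$ be a Finsler metric: $F$ is continuous, positive and smooth on $TM\setminus 0$, $F(\lambda y)=\lambda F(y)$ for $\lambda\ge 0$, and for every $x\in M$ and every nonzero $y\in T_xM$ the form $$\langle u,v\rangle^F_y=\tfrac12\,\frac{\partial^2}{\partial s\,\partial t}F^2(y+su+tv)\Big|_{s=t=0}$$ is positive definite on $T_xM$. In standard local coordinates $(x^i,y^j)$ on $TM$, with $y=y^j\partial_{x^j}$, put (summing over repeated indices) $g_{ij}=\frac12[F^2]_{y^iy^j}$, $(g^{ij})=(g_{ij})^{-1}$, $$G^i=\tfrac14\,g^{il}\big([F^2]_{x^ky^l}y^k-[F^2]_{x^l}\big),$$ and let the Riemann curvature of $F$ at $y\in T_xM\setminus\{0\}$ be the linear map $R^F_y=R^i_k(y)\,\partial_{x^i}\otimes dx^k:T_xM\to T_xM$ with $$R^i_k(y)=2\,\partial_{x^k}G^i-y^j\,\partial^2_{x^jy^k}G^i+2G^j\,\partial^2_{y^jy^k}G^i-\partial_{y^j}G^i\,\partial_{y^k}G^j .$$ For a plane $\mathbf P=\operatorname{span}\{y,v\}\subset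 T_xM$, the flag curvature is $$K^F(x,y,\mathbf P)=\frac{\langle R^F_yv,v\rangle^F_y}{\langle y,y\rangle^F_y\langle v,v\rangle^F_y-(\langle y,v\rangle^F_y)^2}.$$ A geodesic of $F$ is a smooth curve $c$ with $\dot c\neq0$ and $\ddot c^{\,i}+2G^i(c,\dot c)=0$ in all standard local coordinates; its speed $F(\dot c)$ is then constant. Let $Y$ be a smooth vector field on $M$ and let $p\in M$ be such that $y=Y(p)\ne0$. On the open set where $Y\neq 0$, let $g_Y$ be the Riemannian metric $(g_Y)_x=\langle\cdot,\cdot\rangle^F_{Y(x)}$, and let $R^{g_Y}_y$ be the Riemann curvature, in the above sense, of the Finsler metric $v\mapsto\sqrt{g_Y(v,v)}$. Assume that the integral curve of $Y$ through $p$ is, on some open time interval around the time at which it passes through $p$, a geodesic of $F$. Then $$R^F_y=R^{g_Y}_y\quad\text{on }T_pM .$$ Furthermore, for every plane $\mathbf P\subset T_pM$ containing $y$, $$K^F(p,y,\mathbf P)=K^{g_Y}(p,\mathbf P),$$ where $K^{g_Y}(p,\mathbf P)$ is the sectional curvature of the Riemannian metric $g_Y$, i.e. $g_Y(R(u,w)w,u)/\big(g_Y(u,u)g_Y(w,w)-g_Y(u,w)^2\big)$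 for any basis $u,w$ of $\mathbf P$, with $R$ the curvature tensor of the Levi-Civita connection of $g_Y$. -/

import Mathlib

open Set
open scoped Manifold ContDiff

noncomputable section

namespace Finsler

variable {n : ℕ} {M : Type*} [TopologicalSpace M] [ChartedSpace (EuclideanSpace ℝ (Fin n)) M]

/-- The inner product `⟨u, v⟩_y = (1/2) ∂²/∂s∂t F²(y + s u + t v)|_{s=t=0}` on `T_x M`
attached to a nonzero vector `y ∈ T_x M`. -/
def fundamentalTensor (F : TangentBundle (𝓡 n) M → ℝ) (x : M)
    (y u v : TangentSpace (𝓡 n) x) : ℝ :=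
  (1 / 2) * deriv (fun s : ℝ => deriv (fun t : ℝ => F ⟨x, y + s • u + t • v⟩ ^ 2) 0) 0

/-- `F : TM → [0, ∞)` is a Finsler metric: it is continuous, positive and smooth on the slit
tangent bundle, and restricts to a Minkowski norm on each tangent space. -/
structure IsFinslerMetric [IsManifold (𝓡 n) ∞ M] (F : TangentBundle (𝓡 n) M → ℝ) : Prop where
  nonneg : ∀ v, 0 ≤ F v
  continuous : Continuous F
  pos : ∀ (x : M) (y : TangentSpace (𝓡 n) x), y ≠ 0 → 0 < F ⟨x, y⟩
  smooth : ContMDiffOn (𝓡 n).tangent 𝓘(ℝ, ℝ) ∞ F {v | v.2 ≠ 0}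
  homogeneous : ∀ (x : M) (y : TangentSpace (𝓡 n) x) (c : ℝ), 0 ≤ c →
    F ⟨x, c • y⟩ = c * F ⟨x, y⟩
  posDef : ∀ (x : M) (y : TangentSpace (𝓡 n) x), y ≠ 0 → ∀ u : TangentSpace (𝓡 n) x, u ≠ 0 →
    0 < fundamentalTensor F x y u u

/-! ### Coordinate expressions

A function of standard local coordinates `(x, y) = (xⁱ, yʲ)` on `TM` is a function on
`EuclideanSpace ℝ (Fin n) × EuclideanSpace ℝ (Fin n)`. -/

/-- `∂f/∂xᵏ`, for `f` a function of `(x, y)`. -/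
def dx (k : Fin n) (f : EuclideanSpace ℝ (Fin n) × EuclideanSpace ℝ (Fin n) → ℝ) :
    EuclideanSpace ℝ (Fin n) × EuclideanSpace ℝ (Fin n) → ℝ :=
  fun z => fderiv ℝ f z (EuclideanSpace.single k 1, 0)

/-- `∂f/∂yᵏ`, for `f` a function of `(x, y)`. -/
def dy (k : Fin n) (f : EuclideanSpace ℝ (Fin n) × EuclideanSpace ℝ (Fin n) → ℝ) :
    EuclideanSpace ℝ (Fin n) × EuclideanSpace ℝ (Fin n) → ℝ :=
  fun z => fderiv ℝ f z (0, EuclideanSpace.single k 1)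

/-- `F²` in the standard local coordinates `(x, y) ↦ yʲ ∂_{xʲ}|_x` of the chart `e`. -/
def sqInChart (F : TangentBundle (𝓡 n) M → ℝ)
    (e : OpenPartialHomeomorph M (EuclideanSpace ℝ (Fin n)))
    (z : EuclideanSpace ℝ (Fin n) × EuclideanSpace ℝ (Fin n)) : ℝ :=
  F (tangentMap (𝓡 n) (𝓡 n) e.symm ⟨z.1, z.2⟩) ^ 2

/-- The Hessian matrix `g_{ij}(x, y) = (1/2) [F²]_{yⁱ yʲ}`. -/
def hessianMatrix (F : TangentBundle (𝓡 n) M → ℝ)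
    (e : OpenPartialHomeomorph M (EuclideanSpace ℝ (Fin n)))
    (z : EuclideanSpace ℝ (Fin n) × EuclideanSpace ℝ (Fin n)) : Matrix (Fin n) (Fin n) ℝ :=
  Matrix.of fun i j => (1 / 2) * dy i (dy j (sqInChart F e)) z

/-- The spray coefficients `Gⁱ = (1/4) gⁱˡ ([F²]_{xᵏ yˡ} yᵏ - [F²]_{xˡ})`. -/
def sprayCoeff (F : TangentBundle (𝓡 n) M → ℝ)
    (e : OpenPartialHomeomorph M (EuclideanSpace ℝ (Fin n))) (i : Fin n)
    (z : EuclideanSpace ℝ (Fin n) × EuclideanSpace ℝ (Fin n)) : ℝ :=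
  (1 / 4) * ∑ l, (hessianMatrix F e z)⁻¹ i l *
    ((∑ k, dx k (dy l (sqInChart F e)) z * z.2 k) - dx l (sqInChart F e) z)

/-- The components
`Rⁱₖ(y) = 2 ∂_{xᵏ}Gⁱ - yʲ ∂²_{xʲ yᵏ}Gⁱ + 2 Gʲ ∂²_{yʲ yᵏ}Gⁱ - ∂_{yʲ}Gⁱ ∂_{yᵏ}Gʲ`. -/
def riemannCoeff (F : TangentBundle (𝓡 n) M → ℝ)
    (e : OpenPartialHomeomorph M (EuclideanSpace ℝ (Fin n)))
    (z : EuclideanSpace ℝ (Fin n) × EuclideanSpace ℝ (Fin n)) : Matrix (Fin n) (Fin n) ℝ :=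
  Matrix.of fun i k =>
    2 * dx k (sprayCoeff F e i) z
      - (∑ j, z.2 j * dx j (dy k (sprayCoeff F e i)) z)
      + 2 * (∑ j, sprayCoeff F e j z * dy j (dy k (sprayCoeff F e i)) z)
      - ∑ j, dy j (sprayCoeff F e i) z * dy k (sprayCoeff F e j) z

/-- The coordinate vector `(vⁱ)` of a tangent vector `v = vⁱ ∂_{xⁱ} ∈ T_p M`. -/
def coords (e : OpenPartialHomeomorph M (EuclideanSpace ℝ (Fin n))) (p : M) :
    TangentSpace (𝓡 n) p →L[ℝ] EuclideanSpace ℝ (Fin n) :=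
  mfderiv (𝓡 n) 𝓘(ℝ, EuclideanSpace ℝ (Fin n)) e p

/-- The tangent vector `vⁱ ∂_{xⁱ} ∈ T_p M` with coordinate vector `(vⁱ)`. -/
def ofCoords (e : OpenPartialHomeomorph M (EuclideanSpace ℝ (Fin n))) (p : M) :
    EuclideanSpace ℝ (Fin n) →L[ℝ] TangentSpace (𝓡 n) p :=
  (coords e p).inverse

/-- The Riemann curvature `R_y = Rⁱₖ(y) ∂_{xⁱ} ⊗ dxᵏ : T_p M → T_p M`, computed in the chart `e`. -/
def riemannCurvature (F : TangentBundle (𝓡 n) M → ℝ)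
    (e : OpenPartialHomeomorph M (EuclideanSpace ℝ (Fin n))) (p : M)
    (y : TangentSpace (𝓡 n) p) : TangentSpace (𝓡 n) p →ₗ[ℝ] TangentSpace (𝓡 n) p :=
  (ofCoords e p).toLinearMap ∘ₗ
    Matrix.toEuclideanLin (riemannCoeff F e (e p, coords e p y)) ∘ₗ
      (coords e p).toLinearMap

/-- The flag curvature `K(p, y, y ∧ v)`, computed in the chart `e`. -/
def flagCurvature (F : TangentBundle (𝓡 n) M → ℝ)
    (e : OpenPartialHomeomorph M (EuclideanSpace ℝ (Fin n))) (p : M)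
    (y v : TangentSpace (𝓡 n) p) : ℝ :=
  fundamentalTensor F p y (riemannCurvature F e p y v) v /
    (fundamentalTensor F p y y y * fundamentalTensor F p y v v - fundamentalTensor F p y y v ^ 2)

/-- `γ` is a geodesic on the open set `s` of times: a smooth regular curve with
`c̈ⁱ + 2 Gⁱ(c, ċ) = 0` in every chart of the smooth structure. (The speed `F(γ̇)` of such a curve
is automatically constant on intervals.) -/
def IsGeodesicOn (F : TangentBundle (𝓡 n) M → ℝ) (γ : ℝ → M) (s : Set ℝ) : Prop :=
  ContMDiffOn 𝓘(ℝ, ℝ) (𝓡 n) ∞ γ s ∧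
  ∀ e ∈ IsManifold.maximalAtlas (𝓡 n) ∞ M, ∀ t ∈ s, γ t ∈ e.source →
    deriv (fun τ => e (γ τ)) t ≠ 0 ∧
    ∀ i, deriv (deriv fun τ => e (γ τ) i) t +
      2 * sprayCoeff F e i (e (γ t), deriv (fun τ => e (γ τ)) t) = 0

/-- Some integral curve of `Y` through `p`, defined on a time interval around `0`,
is a geodesic of `F`. -/
def GeneratesGeodesicThrough (F : TangentBundle (𝓡 n) M → ℝ)
    (Y : (x : M) → TangentSpace (𝓡 n) x) (p : M) : Prop :=
  ∃ (γ : ℝ → M) (ε : ℝ), 0 < ε ∧ γ 0 = p ∧ IsMIntegralCurveOn γ Y (Ioo (-ε) ε) ∧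
    IsGeodesicOn F γ (Ioo (-ε) ε)

/-! ### The localized Riemannian metric and Riemannian curvature -/

/-- The localization `g_Y` of `F` at `Y`: the inner product `⟨·,·⟩_{Y(x)}` on `T_x M`. It is a
Riemannian metric on the open set where `Y` does not vanish. -/
def localization (F : TangentBundle (𝓡 n) M → ℝ) (Y : (x : M) → TangentSpace (𝓡 n) x) (x : M)
    (u v : TangentSpace (𝓡 n) x) : ℝ :=
  fundamentalTensor F x (Y x) u v

/-- A Riemannian metric `g` regarded as a Finsler metric: `v ↦ √g(v, v)`. -/
def riemannianNorm (g : (x : M) → TangentSpace (𝓡 n) x → TangentSpace (𝓡 n) x → ℝ)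
    (v : TangentBundle (𝓡 n) M) : ℝ :=
  √(g v.1 v.2 v.2)

/-- The matrix `g_{ij}(x) = g(∂_{xⁱ}, ∂_{xʲ})` of a Riemannian metric in the chart `e`. -/
def metricMatrix (g : (x : M) → TangentSpace (𝓡 n) x → TangentSpace (𝓡 n) x → ℝ)
    (e : OpenPartialHomeomorph M (EuclideanSpace ℝ (Fin n)))
    (x : EuclideanSpace ℝ (Fin n)) : Matrix (Fin n) (Fin n) ℝ :=
  Matrix.of fun i j => g (e.symm x)
    (mfderiv (𝓡 n) (𝓡 n) e.symm x (EuclideanSpace.single i (1 : ℝ) : EuclideanSpace ℝ (Fin n)))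
    (mfderiv (𝓡 n) (𝓡 n) e.symm x (EuclideanSpace.single j (1 : ℝ) : EuclideanSpace ℝ (Fin n)))

/-- `∂f/∂xᵏ`, for `f` a function of `x`. -/
def pd (k : Fin n) (f : EuclideanSpace ℝ (Fin n) → ℝ) (x : EuclideanSpace ℝ (Fin n)) : ℝ :=
  fderiv ℝ f x (EuclideanSpace.single k 1)

/-- The Christoffel symbols
`Γⁱ_{jk} = (1/2) gⁱˡ (∂_j g_{lk} + ∂_k g_{lj} - ∂_l g_{jk})` of the Levi-Civita connection. -/
def christoffel (g : (x : M) → TangentSpace (𝓡 n) x → TangentSpace (𝓡 n) x → ℝ)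
    (e : OpenPartialHomeomorph M (EuclideanSpace ℝ (Fin n))) (i j k : Fin n)
    (x : EuclideanSpace ℝ (Fin n)) : ℝ :=
  (1 / 2) * ∑ l, (metricMatrix g e x)⁻¹ i l *
    (pd j (fun x' => metricMatrix g e x' l k) x + pd k (fun x' => metricMatrix g e x' l j) x
      - pd l (fun x' => metricMatrix g e x' j k) x)

/-- The components of the curvature tensor of the Levi-Civita connection:
`R(∂_i, ∂_j) ∂_k = (∂_i Γˡ_{jk} - ∂_j Γˡ_{ik} + Γˡ_{im} Γᵐ_{jk} - Γˡ_{jm} Γᵐ_{ik}) ∂_l`. -/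
def curvatureCoeff (g : (x : M) → TangentSpace (𝓡 n) x → TangentSpace (𝓡 n) x → ℝ)
    (e : OpenPartialHomeomorph M (EuclideanSpace ℝ (Fin n))) (l i j k : Fin n)
    (x : EuclideanSpace ℝ (Fin n)) : ℝ :=
  pd i (christoffel g e l j k) x - pd j (christoffel g e l i k) x
    + (∑ m, christoffel g e l i m x * christoffel g e m j k x)
    - ∑ m, christoffel g e l j m x * christoffel g e m i k x

/-- The curvature tensor `R(u, v) w = ∇_u ∇_v w - ∇_v ∇_u w - ∇_{[u, v]} w` at `p`, computed in the
chart `e`. -/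
def curvatureTensor (g : (x : M) → TangentSpace (𝓡 n) x → TangentSpace (𝓡 n) x → ℝ)
    (e : OpenPartialHomeomorph M (EuclideanSpace ℝ (Fin n))) (p : M)
    (u v w : TangentSpace (𝓡 n) p) : TangentSpace (𝓡 n) p :=
  ofCoords e p (WithLp.toLp 2 fun l => ∑ i, ∑ j, ∑ k,
    curvatureCoeff g e l i j k (e p) * coords e p u i * coords e p v j * coords e p w k)

/-- The sectional curvature of the plane spanned by `u` and `v`, computed in the chart `e`. -/
def sectionalCurvature (g : (x : M) → TangentSpace (𝓡 n) x → TangentSpace (𝓡 n) x → ℝ)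
    (e : OpenPartialHomeomorph M (EuclideanSpace ℝ (Fin n))) (p : M)
    (u v : TangentSpace (𝓡 n) p) : ℝ :=
  g p (curvatureTensor g e p u v v) u / (g p u u * g p v v - g p u v ^ 2)

end Finsler

end

/-! Work in one chart. Put `L = F²`, let `V` be the coordinate field of `Y`, and let `m(x) =
g_{ij}(x, V x)` be the Hessian of `L/2` frozen along `V`. The squared norm of `g_Y` is then the
quadratic Lagrangian of `m`. Three comparisons between `L` and this quadratic Lagrangian give the
equality of Riemann curvatures.

The sprays agree along `V` on the whole domain (`lagrangianSpray_localized`). Differentiating `m`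
produces an extra term, the third fibre derivative of `L` times the derivative of `V`; it disappears
on contraction with `V`, because third fibre derivatives of a 2-homogeneous function annihilate `y`
(`sum_dy_dy_dy_mul`).

Wherever `V` satisfies the geodesic equation, the connection coefficients `∂Gⁱ/∂yʲ` agree as well
(`dy_lagrangianSpray_localized`). Both solve a linear system with the same invertible Hessian. The
extra term in the derivative of `m` along `V` contains `Vᵏ ∂_k Vˡ = -2Gˡ`, and so supplies exactly
the cubic term that is present for `L` and absent for a quadratic Lagrangian.

At a geodesic point the curvature can be written without second fibre derivatives of `G`
(`sprayRiemann_section`): it involves the first derivatives of `x ↦ Gⁱ(x, V x)`, the connection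
coefficients, and the derivative of the latter in the direction `V`. That direction is tangent to
the integral curve, so agreement on the curve alone suffices (`sprayRiemann_localized`).

For the flag curvature, the Riemann curvature of a quadratic spray is `v ↦ R(v, y) y`
(`sprayRiemann_quadraticLagrangian`). The two antisymmetries of the Levi-Civita curvature make
`g(R(u, w) w, u)` scale by the squared determinant of a change of basis, as the Gram determinant
does, so the sectional curvature may be computed in the basis `y, v`. -/

noncomputable section

namespace Finsler

/-! ### Directional derivatives of smooth functions on open sets -/

section DirDeriv

variable {W : Type*} [NormedAddCommGroup W] [NormedSpace ℝ W]

/-- The directional derivative of a real function. -/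
def dirDeriv (v : W) (f : W → ℝ) : W → ℝ := fun z => fderiv ℝ f z v

variable {Ω : Set W} {f g : W → ℝ} {u v z : W}

lemma dirDeriv_congr (hΩ : IsOpen Ω) (h : EqOn f g Ω) : EqOn (dirDeriv v f) (dirDeriv v g) Ω := by
  intro z hz
  have : f =ᶠ[nhds z] g := Filter.eventuallyEq_of_mem (hΩ.mem_nhds hz) h
  simp only [dirDeriv, this.fderiv_eq]

lemma contDiffOn_dirDeriv (hΩ : IsOpen Ω) (hf : ContDiffOn ℝ ∞ f Ω) (v : W) :
    ContDiffOn ℝ ∞ (dirDeriv v f) Ω :=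
  (hf.fderiv_of_isOpen hΩ (by simp)).clm_apply contDiffOn_const

lemma differentiableAt_of_contDiffOn (hΩ : IsOpen Ω) (hf : ContDiffOn ℝ ∞ f Ω) (hz : z ∈ Ω) :
    DifferentiableAt ℝ f z :=
  (hf.contDiffAt (hΩ.mem_nhds hz)).differentiableAt (by simp)

lemma dirDeriv_comm (hΩ : IsOpen Ω) (hf : ContDiffOn ℝ ∞ f Ω) (hz : z ∈ Ω) (u v : W) :
    dirDeriv u (dirDeriv v f) z = dirDeriv v (dirDeriv u f) z := by
  have hs : IsSymmSndFDerivAt ℝ f z :=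
    (hf.contDiffAt (hΩ.mem_nhds hz)).isSymmSndFDerivAt
      (by rw [minSmoothness_of_isRCLikeNormedField]; exact ENat.LEInfty.out)
  have hd : DifferentiableAt ℝ (fderiv ℝ f) z :=
    ((hf.fderiv_of_isOpen (m := ∞) hΩ (by simp)).contDiffAt
      (hΩ.mem_nhds hz)).differentiableAt (by simp)
  have key : ∀ u v : W, dirDeriv u (dirDeriv v f) z = fderiv ℝ (fderiv ℝ f) z u v := by
    intro u v
    change fderiv ℝ (fun z => fderiv ℝ f z v) z u = _
    rw [fderiv_clm_apply hd (differentiableAt_const v)]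
    simp
  rw [key, key, hs.eq]

lemma dirDeriv_const_mul (c : ℝ) (f : W → ℝ) :
    dirDeriv v (fun z => c * f z) z = c * dirDeriv v f z := by
  have : (fun z => c * f z) = c • f := rfl
  simp only [dirDeriv, this, fderiv_const_smul_field, Pi.smul_apply]
  simp

lemma dirDeriv_add (hf : DifferentiableAt ℝ f z) (hg : DifferentiableAt ℝ g z) :
    dirDeriv v (fun z => f z + g z) z = dirDeriv v f z + dirDeriv v g z := by
  simp [dirDeriv, fderiv_fun_add hf hg]

lemma dirDeriv_sub (hf : DifferentiableAt ℝ f z) (hg : DifferentiableAt ℝ g z) :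
    dirDeriv v (fun z => f z - g z) z = dirDeriv v f z - dirDeriv v g z := by
  simp [dirDeriv, fderiv_fun_sub hf hg]

lemma dirDeriv_mul (hf : DifferentiableAt ℝ f z) (hg : DifferentiableAt ℝ g z) :
    dirDeriv v (fun z => f z * g z) z = dirDeriv v f z * g z + f z * dirDeriv v g z := by
  simp [dirDeriv, fderiv_fun_mul hf hg]
  ring

lemma dirDeriv_sum {ι : Type*} [Fintype ι] {f : ι → W → ℝ} (hf : ∀ i, DifferentiableAt ℝ (f i) z) :
    dirDeriv v (fun z => ∑ i, f i z) z = ∑ i, dirDeriv v (f i) z := by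
  simp [dirDeriv, fderiv_fun_sum (fun i _ => hf i)]

lemma dirDeriv_sum_mul {ι : Type*} [Fintype ι] {f g : ι → W → ℝ}
    (hf : ∀ i, DifferentiableAt ℝ (f i) z) (hg : ∀ i, DifferentiableAt ℝ (g i) z) :
    dirDeriv v (fun z => ∑ i, f i z * g i z) z =
      ∑ i, dirDeriv v (f i) z * g i z + ∑ i, f i z * dirDeriv v (g i) z := by
  rw [dirDeriv_sum (f := fun i z => f i z * g i z) (fun i => (hf i).mul (hg i)),
    ← Finset.sum_add_distrib]
  exact Finset.sum_congr rfl fun i _ => dirDeriv_mul (hf i) (hg i)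

end DirDeriv

/-! ### Smoothness of inverse matrices -/

section Inverse

variable {W : Type*} [NormedAddCommGroup W] [NormedSpace ℝ W] {Ω : Set W}
  {ι : Type*} [Fintype ι] [DecidableEq ι]

lemma contDiffOn_det {A : W → Matrix ι ι ℝ} (h : ∀ i j, ContDiffOn ℝ ∞ (fun z => A z i j) Ω) :
    ContDiffOn ℝ ∞ (fun z => (A z).det) Ω := by
  simp only [Matrix.det_apply']
  exact ContDiffOn.sum fun σ _ => contDiffOn_const.mul (contDiffOn_prod fun i _ => h _ _)

lemma contDiffOn_inv_apply {A : W → Matrix ι ι ℝ}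
    (h : ∀ i j, ContDiffOn ℝ ∞ (fun z => A z i j) Ω) (hdet : ∀ z ∈ Ω, IsUnit (A z).det)
    (i j : ι) : ContDiffOn ℝ ∞ (fun z => (A z)⁻¹ i j) Ω := by
  have hadj : ContDiffOn ℝ ∞ (fun z => (A z).adjugate i j) Ω := by
    -- An adjugate entry is the determinant of `A` with one row replaced by a constant basis vector,
    -- hence still polynomial in smooth entries.
    simp only [Matrix.adjugate_apply]
    refine contDiffOn_det fun k l => ?_
    by_cases hk : k = j
    · subst hk
      simpa using contDiffOn_const
    · simpa [Matrix.updateRow_ne hk] using h k l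
  simp only [Matrix.inv_def, Ring.inverse_eq_inv', Matrix.smul_apply, smul_eq_mul]
  exact ((contDiffOn_det h).inv fun z hz => (hdet z hz).ne_zero).mul hadj

lemma sum_mul_inv_mulVec {A : Matrix ι ι ℝ} (hA : IsUnit A.det) (b : ι → ℝ) (i : ι) :
    ∑ l, A i l * ∑ m, A⁻¹ l m * b m = b i := by
  have : A.mulVec (A⁻¹.mulVec b) = b := by
    rw [Matrix.mulVec_mulVec, Matrix.mul_nonsing_inv _ hA, Matrix.one_mulVec]
  simpa [Matrix.mulVec, dotProduct] using congrFun this i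

lemma eq_of_sum_mul_eq {A : Matrix ι ι ℝ} (hA : IsUnit A.det) {b c : ι → ℝ}
    (h : ∀ i, ∑ l, A i l * b l = ∑ l, A i l * c l) : b = c :=
  Matrix.mulVec_injective_of_isUnit ((Matrix.isUnit_iff_isUnit_det A).2 hA)
    (funext fun i => by simpa [Matrix.mulVec, dotProduct] using h i)

end Inverse

/-! ### Sprays of functions on `TM` in coordinates -/

variable {n : ℕ}

notation "𝔼" n:max => EuclideanSpace ℝ (Fin n)

/-- The Hessian matrix `(1/2) [L]_{yⁱ yʲ}` of a Lagrangian. -/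
def lagrangianHessian (L : 𝔼 n × 𝔼 n → ℝ) (z : 𝔼 n × 𝔼 n) : Matrix (Fin n) (Fin n) ℝ :=
  Matrix.of fun i j => (1 / 2) * dy i (dy j L) z

/-- The spray coefficients of a Lagrangian. -/
def lagrangianSpray (L : 𝔼 n × 𝔼 n → ℝ) (i : Fin n) (z : 𝔼 n × 𝔼 n) : ℝ :=
  (1 / 4) * ∑ l, (lagrangianHessian L z)⁻¹ i l *
    ((∑ k, dx k (dy l L) z * z.2 k) - dx l L z)

/-- The Riemann curvature components of the spray with coefficients `G`. -/
def sprayRiemann (G : Fin n → 𝔼 n × 𝔼 n → ℝ) (z : 𝔼 n × 𝔼 n) : Matrix (Fin n) (Fin n) ℝ :=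
  Matrix.of fun i k =>
    2 * dx k (G i) z - (∑ j, z.2 j * dx j (dy k (G i)) z)
      + 2 * (∑ j, G j z * dy j (dy k (G i)) z) - ∑ j, dy j (G i) z * dy k (G j) z

lemma dx_eq_dirDeriv (k : Fin n) :
    (dx k : (𝔼 n × 𝔼 n → ℝ) → 𝔼 n × 𝔼 n → ℝ) = dirDeriv (EuclideanSpace.single k 1, 0) := rfl

lemma dy_eq_dirDeriv (k : Fin n) :
    (dy k : (𝔼 n × 𝔼 n → ℝ) → 𝔼 n × 𝔼 n → ℝ) = dirDeriv (0, EuclideanSpace.single k 1) := rfl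

lemma pd_eq_dirDeriv (k : Fin n) :
    (pd k : (𝔼 n → ℝ) → 𝔼 n → ℝ) = dirDeriv (EuclideanSpace.single k 1) := rfl

lemma clm_apply_eq_sum (A : 𝔼 n →L[ℝ] ℝ) (v : 𝔼 n) :
    A v = ∑ k, A (EuclideanSpace.single k 1) * v k := by
  have hv : v = ∑ k, v k • EuclideanSpace.single k (1 : ℝ) := by
    simpa using ((EuclideanSpace.basisFun (Fin n) ℝ).sum_repr v).symm
  conv_lhs => rw [hv]
  simp [mul_comm]

lemma clm_prod_apply_eq_sum (A : 𝔼 n × 𝔼 n →L[ℝ] ℝ) (u v : 𝔼 n) :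
    A (u, v) = ∑ k, A (EuclideanSpace.single k 1, 0) * u k
      + ∑ k, A (0, EuclideanSpace.single k 1) * v k := by
  have h1 := clm_apply_eq_sum (A.comp (ContinuousLinearMap.inl ℝ (𝔼 n) (𝔼 n))) u
  have h2 := clm_apply_eq_sum (A.comp (ContinuousLinearMap.inr ℝ (𝔼 n) (𝔼 n))) v
  have : ((u, v) : 𝔼 n × 𝔼 n) = (u, 0) + (0, v) := by simp
  rw [this, map_add]
  simpa using congrArg₂ (· + ·) h1 h2

lemma contDiff_snd_apply (k : Fin n) : ContDiff ℝ ∞ (fun z : 𝔼 n × 𝔼 n => z.2 k) :=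
  (EuclideanSpace.proj (𝕜 := ℝ) k).contDiff.comp contDiff_snd

lemma differentiableAt_snd_apply (k : Fin n) (z : 𝔼 n × 𝔼 n) :
    DifferentiableAt ℝ (fun z : 𝔼 n × 𝔼 n => z.2 k) z :=
  (contDiff_snd_apply k).differentiable (by simp) z

lemma dirDeriv_snd_apply (v : 𝔼 n × 𝔼 n) (k : Fin n) (z : 𝔼 n × 𝔼 n) :
    dirDeriv v (fun z : 𝔼 n × 𝔼 n => z.2 k) z = v.2 k := by
  have : HasFDerivAt (fun z : 𝔼 n × 𝔼 n => z.2 k)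
      ((EuclideanSpace.proj (𝕜 := ℝ) k).comp (ContinuousLinearMap.snd ℝ (𝔼 n) (𝔼 n))) z :=
    ((EuclideanSpace.proj (𝕜 := ℝ) k).comp (ContinuousLinearMap.snd ℝ (𝔼 n) (𝔼 n))).hasFDerivAt
  simp [dirDeriv, this.fderiv]

/-- The chain rule along a section `x ↦ (x, V x)`. -/
lemma pd_comp_section {f : 𝔼 n × 𝔼 n → ℝ} {V : 𝔼 n → 𝔼 n} {x : 𝔼 n} (hf : DifferentiableAt ℝ f (x, V x))
    (hV : DifferentiableAt ℝ V x) (k : Fin n) :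
    pd k (fun x => f (x, V x)) x
      = dx k f (x, V x) + ∑ m, dy m f (x, V x) * pd k (fun x => V x m) x := by
  have h1 : HasFDerivAt (fun x => (x, V x)) ((ContinuousLinearMap.id ℝ (𝔼 n)).prod (fderiv ℝ V x)) x :=
    (hasFDerivAt_id x).prodMk hV.hasFDerivAt
  have h2 := (hf.hasFDerivAt.comp x h1).fderiv
  have h3 : ∀ m v, fderiv ℝ (fun x => V x m) x v = fderiv ℝ V x v m := by
    intro m v
    have := ((EuclideanSpace.proj (𝕜 := ℝ) m).hasFDerivAt.comp x hV.hasFDerivAt).fderiv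
    have h4 : (fun x => V x m) = (EuclideanSpace.proj (𝕜 := ℝ) m : 𝔼 n → ℝ) ∘ V := rfl
    rw [h4, this]
    simp
  simp only [pd, dx, dy, h3]
  change fderiv ℝ (f ∘ fun x => (x, V x)) x _ = _
  rw [h2, ContinuousLinearMap.comp_apply]
  change fderiv ℝ f (x, V x) (EuclideanSpace.single k 1, fderiv ℝ V x _) = _
  rw [clm_prod_apply_eq_sum]
  congr 1
  simp

/-- The derivative of a function along a curve. -/
lemma deriv_comp_eq_sum_pd {f : 𝔼 n → ℝ} {c : ℝ → 𝔼 n} {t : ℝ} {v : 𝔼 n}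
    (hf : DifferentiableAt ℝ f (c t)) (hc : HasDerivAt c v t) :
    HasDerivAt (fun τ => f (c τ)) (∑ k, v k * pd k f (c t)) t := by
  have := hf.hasFDerivAt.comp_hasDerivAt t hc
  rw [clm_apply_eq_sum] at this
  simpa [pd, mul_comm, Function.comp_def] using this

/-! ### Homogeneous Lagrangians and their sprays -/

section Lagrangian

variable {L : 𝔼 n × 𝔼 n → ℝ} {Ω : Set (𝔼 n × 𝔼 n)}

lemma contDiffOn_dx (hΩ : IsOpen Ω) {f : 𝔼 n × 𝔼 n → ℝ} (hf : ContDiffOn ℝ ∞ f Ω) (k : Fin n) :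
    ContDiffOn ℝ ∞ (dx k f) Ω :=
  contDiffOn_dirDeriv hΩ hf _

lemma contDiffOn_dy (hΩ : IsOpen Ω) {f : 𝔼 n × 𝔼 n → ℝ} (hf : ContDiffOn ℝ ∞ f Ω) (k : Fin n) :
    ContDiffOn ℝ ∞ (dy k f) Ω :=
  contDiffOn_dirDeriv hΩ hf _

lemma sum_mul_single (f : Fin n → ℝ) (k : Fin n) :
    ∑ l, f l * (EuclideanSpace.single k (1 : ℝ) : 𝔼 n) l = f k := by
  simp

/-- Euler's identity for a function that is positively homogeneous of degree two. -/
lemma sum_dy_mul (hΩ : IsOpen Ω) (hL : ContDiffOn ℝ ∞ L Ω)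
    (hhom : ∀ z ∈ Ω, ∀ c : ℝ, 0 < c → L (z.1, c • z.2) = c ^ 2 * L z) {z : 𝔼 n × 𝔼 n} (hz : z ∈ Ω) :
    ∑ l, dy l L z * z.2 l = 2 * L z := by
  have h1 : HasDerivAt (fun c : ℝ => (z.1, c • z.2)) (0, z.2) 1 := by
    have := (hasDerivAt_const (1 : ℝ) z.1).prodMk ((hasDerivAt_id (1 : ℝ)).smul_const z.2)
    simpa using this
  have hz1 : ((z.1, (1 : ℝ) • z.2) : 𝔼 n × 𝔼 n) = z := by simp
  have hd : HasFDerivAt L (fderiv ℝ L z) (z.1, (1 : ℝ) • z.2) := by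
    rw [hz1]
    exact (differentiableAt_of_contDiffOn hΩ hL hz).hasFDerivAt
  have h2 := hd.comp_hasDerivAt (1 : ℝ) h1
  have h3 : HasDerivAt (fun c : ℝ => c ^ 2 * L z) (2 * L z) 1 := by
    simpa using ((hasDerivAt_id (1 : ℝ)).pow 2).mul_const (L z)
  -- Homogeneity for positive factors suffices, since only `c` near 1 matters.
  have h4 : (L ∘ fun c : ℝ => (z.1, c • z.2)) =ᶠ[nhds 1] fun c : ℝ => c ^ 2 * L z := by
    filter_upwards [Ioi_mem_nhds one_pos] with c hc using hhom z hz c hc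
  have h5 := (h2.congr_of_eventuallyEq h4.symm).unique h3
  rw [clm_prod_apply_eq_sum] at h5
  simpa [dy] using h5

/-- Directional derivatives of an expression `f_l(x, y) yˡ`. -/
lemma dirDeriv_sum_dy_mul (hΩ : IsOpen Ω) {f : Fin n → 𝔼 n × 𝔼 n → ℝ}
    (hf : ∀ l, ContDiffOn ℝ ∞ (f l) Ω) {z : 𝔼 n × 𝔼 n} (hz : z ∈ Ω) (v : 𝔼 n × 𝔼 n) :
    dirDeriv v (fun z => ∑ l, f l z * z.2 l) z =
      ∑ l, dirDeriv v (f l) z * z.2 l + ∑ l, f l z * v.2 l := by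
  rw [dirDeriv_sum_mul (fun l => differentiableAt_of_contDiffOn hΩ (hf l) hz)
    (fun l => differentiableAt_snd_apply l z)]
  simp only [dirDeriv_snd_apply]

variable (hΩ : IsOpen Ω) (hL : ContDiffOn ℝ ∞ L Ω)

include hΩ hL

lemma dy_dy_comm {z : 𝔼 n × 𝔼 n} (hz : z ∈ Ω) (i j : Fin n) :
    dy i (dy j L) z = dy j (dy i L) z :=
  dirDeriv_comm hΩ hL hz _ _

/-- Differentiating Euler's identity in `yⁱ` yields one extra `∂L/∂yⁱ` on the left against two on
the right: the fibre gradient is 1-homogeneous. -/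
lemma sum_dy_dy_mul
    (hE : ∀ z ∈ Ω, ∑ l, dy l L z * z.2 l = 2 * L z) {z : 𝔼 n × 𝔼 n} (hz : z ∈ Ω) (i : Fin n) :
    ∑ l, dy i (dy l L) z * z.2 l = dy i L z := by
  have h := dirDeriv_congr (v := (0, EuclideanSpace.single i 1)) hΩ hE hz
  rw [dirDeriv_sum_dy_mul hΩ (contDiffOn_dy hΩ hL) hz, sum_mul_single, dirDeriv_const_mul] at h
  simp only [dy_eq_dirDeriv] at *
  linarith

lemma sum_dx_dy_mul
    (hE : ∀ z ∈ Ω, ∑ l, dy l L z * z.2 l = 2 * L z) {z : 𝔼 n × 𝔼 n} (hz : z ∈ Ω) (k : Fin n) :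
    ∑ l, dx k (dy l L) z * z.2 l = 2 * dx k L z := by
  have h := dirDeriv_congr (v := (EuclideanSpace.single k 1, 0)) hΩ hE hz
  rw [dirDeriv_sum_dy_mul hΩ (contDiffOn_dy hΩ hL) hz, dirDeriv_const_mul] at h
  simpa only [← dx_eq_dirDeriv, PiLp.zero_apply, mul_zero, Finset.sum_const_zero, add_zero] using h

lemma sum_dx_dy_dy_mul
    (hE : ∀ z ∈ Ω, ∑ l, dy l L z * z.2 l = 2 * L z) {z : 𝔼 n × 𝔼 n} (hz : z ∈ Ω) (k i : Fin n) :
    ∑ l, dx k (dy i (dy l L)) z * z.2 l = dx k (dy i L) z := by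
  have h := dirDeriv_congr (v := (EuclideanSpace.single k 1, 0)) hΩ
    (fun z hz => sum_dy_dy_mul hΩ hL hE hz i) hz
  rw [dirDeriv_sum_dy_mul hΩ (fun l => contDiffOn_dy hΩ (contDiffOn_dy hΩ hL l) i) hz] at h
  simpa only [← dx_eq_dirDeriv, PiLp.zero_apply, mul_zero, Finset.sum_const_zero, add_zero] using h

/-- The Hessian is 0-homogeneous in `y`, so the Cartan tensor annihilates `y`. This is the
cancellation behind the comparison of sprays. -/
lemma sum_dy_dy_dy_mul
    (hE : ∀ z ∈ Ω, ∑ l, dy l L z * z.2 l = 2 * L z) {z : 𝔼 n × 𝔼 n} (hz : z ∈ Ω) (j i : Fin n) :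
    ∑ l, dy j (dy i (dy l L)) z * z.2 l = 0 := by
  have h := dirDeriv_congr (v := (0, EuclideanSpace.single j 1)) hΩ
    (fun z hz => sum_dy_dy_mul hΩ hL hE hz i) hz
  rw [dirDeriv_sum_dy_mul hΩ (fun l => contDiffOn_dy hΩ (contDiffOn_dy hΩ hL l) i) hz,
    sum_mul_single] at h
  have h' := dy_dy_comm hΩ hL hz i j
  simp only [dy_eq_dirDeriv] at *
  linarith

lemma contDiffOn_lagrangianHessian (i j : Fin n) :
    ContDiffOn ℝ ∞ (fun z => lagrangianHessian L z i j) Ω :=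
  contDiffOn_const.mul (contDiffOn_dy hΩ (contDiffOn_dy hΩ hL j) i)

variable (hdet : ∀ z ∈ Ω, IsUnit (lagrangianHessian L z).det)

include hdet

lemma contDiffOn_lagrangianSpray (i : Fin n) : ContDiffOn ℝ ∞ (lagrangianSpray L i) Ω := by
  refine contDiffOn_const.mul (ContDiffOn.sum fun l _ => ContDiffOn.mul ?_ (ContDiffOn.sub ?_ ?_))
  · exact contDiffOn_inv_apply (contDiffOn_lagrangianHessian hΩ hL) hdet i l
  · exact ContDiffOn.sum fun k _ => (contDiffOn_dx hΩ (contDiffOn_dy hΩ hL l) k).mul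
      (contDiff_snd_apply k).contDiffOn
  · exact contDiffOn_dx hΩ hL l

omit hΩ hL in
/-- The defining relation of the spray coefficients, with the Hessian cleared. -/
lemma sum_dy_dy_mul_lagrangianSpray {z : 𝔼 n × 𝔼 n} (hz : z ∈ Ω) (i : Fin n) :
    ∑ l, dy i (dy l L) z * lagrangianSpray L l z
      = (1 / 2) * ((∑ k, dx k (dy i L) z * z.2 k) - dx i L z) := by
  have h := sum_mul_inv_mulVec (hdet z hz) (fun l => (∑ k, dx k (dy l L) z * z.2 k) - dx l L z) i
  rw [← h, Finset.mul_sum]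
  refine Finset.sum_congr rfl fun l _ => ?_
  simp only [lagrangianSpray, lagrangianHessian, Matrix.of_apply]
  ring

/-- The `y`-derivatives of the spray coefficients. -/
lemma sum_dy_dy_mul_dy_lagrangianSpray {z : 𝔼 n × 𝔼 n} (hz : z ∈ Ω) (i j : Fin n) :
    ∑ l, dy i (dy l L) z * dy j (lagrangianSpray L l) z
      = (1 / 2) * ((∑ k, dx k (dy j (dy i L)) z * z.2 k) + dx j (dy i L) z - dx i (dy j L) z)
        - ∑ l, dy j (dy i (dy l L)) z * lagrangianSpray L l z := by
  have hdd : ∀ i, ContDiffOn ℝ ∞ (dy i L) Ω := contDiffOn_dy hΩ hL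
  -- Differentiating the relation with the Hessian cleared avoids any derivative of the inverse
  -- Hessian.
  have h := dirDeriv_congr (v := (0, EuclideanSpace.single j 1)) hΩ
    (fun z hz => sum_dy_dy_mul_lagrangianSpray hdet hz i) hz
  have hs : DifferentiableAt ℝ (fun z : 𝔼 n × 𝔼 n => ∑ k, dx k (dy i L) z * z.2 k) z :=
    differentiableAt_of_contDiffOn hΩ (ContDiffOn.sum fun k _ =>
      (contDiffOn_dx hΩ (hdd i) k).mul (contDiff_snd_apply k).contDiffOn) hz
  rw [dirDeriv_sum_mul
      (fun l => differentiableAt_of_contDiffOn hΩ (contDiffOn_dy hΩ (hdd l) i) hz)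
      (fun l => differentiableAt_of_contDiffOn hΩ (contDiffOn_lagrangianSpray hΩ hL hdet l) hz),
    dirDeriv_const_mul,
    dirDeriv_sub hs (differentiableAt_of_contDiffOn hΩ (contDiffOn_dx hΩ hL i) hz),
    dirDeriv_sum_dy_mul hΩ (contDiffOn_dx hΩ (hdd i)) hz, sum_mul_single] at h
  have c1 : ∀ k, dy j (dx k (dy i L)) z = dx k (dy j (dy i L)) z := fun k =>
    dirDeriv_comm hΩ (hdd i) hz _ _
  have c2 : dy j (dx i L) z = dx i (dy j L) z := dirDeriv_comm hΩ hL hz _ _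
  simp only [← dy_eq_dirDeriv, c1, c2] at h
  linarith

end Lagrangian

/-! ### Quadratic Lagrangians -/

section Quadratic

/-- The Lagrangian `m_{ij}(x) yⁱ yʲ`. -/
def quadraticLagrangian (m : (𝔼 n) → Matrix (Fin n) (Fin n) ℝ) (z : 𝔼 n × 𝔼 n) : ℝ :=
  ∑ i, (∑ j, m z.1 i j * z.2 j) * z.2 i

/-- The Christoffel symbols of a matrix-valued function. -/
def matrixChristoffel (m : (𝔼 n) → Matrix (Fin n) (Fin n) ℝ) (i j k : Fin n) (x : 𝔼 n) : ℝ :=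
  (1 / 2) * ∑ l, (m x)⁻¹ i l *
    (pd j (fun x' => m x' l k) x + pd k (fun x' => m x' l j) x - pd l (fun x' => m x' j k) x)

variable {m : (𝔼 n) → Matrix (Fin n) (Fin n) ℝ} {U : Set (𝔼 n)}

lemma dirDeriv_comp_fst {f : (𝔼 n) → ℝ} {z : 𝔼 n × 𝔼 n} (hf : DifferentiableAt ℝ f z.1)
    (v : 𝔼 n × 𝔼 n) : dirDeriv v (fun z : 𝔼 n × 𝔼 n => f z.1) z = dirDeriv v.1 f z.1 := by
  have := (hf.hasFDerivAt.comp z (ContinuousLinearMap.fst ℝ (𝔼 n) (𝔼 n)).hasFDerivAt).fderiv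
  change fderiv ℝ (f ∘ Prod.fst) z _ = _
  rw [this]
  rfl

lemma dx_comp_fst {f : (𝔼 n) → ℝ} {z : 𝔼 n × 𝔼 n} (hf : DifferentiableAt ℝ f z.1) (k : Fin n) :
    dx k (fun z : 𝔼 n × 𝔼 n => f z.1) z = pd k f z.1 :=
  dirDeriv_comp_fst hf _

lemma dy_comp_fst {f : (𝔼 n) → ℝ} {z : 𝔼 n × 𝔼 n} (hf : DifferentiableAt ℝ f z.1) (k : Fin n) :
    dy k (fun z : 𝔼 n × 𝔼 n => f z.1) z = 0 := by
  rw [dy_eq_dirDeriv, dirDeriv_comp_fst hf]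
  simp [dirDeriv]

lemma contDiffOn_comp_fst {f : (𝔼 n) → ℝ} (hf : ContDiffOn ℝ ∞ f U) :
    ContDiffOn ℝ ∞ (fun z : 𝔼 n × 𝔼 n => f z.1) (U ×ˢ univ) :=
  hf.comp contDiff_fst.contDiffOn fun _ hz => hz.1

lemma contDiffOn_linearForm {a : Fin n → (𝔼 n) → ℝ} (ha : ∀ j, ContDiffOn ℝ ∞ (a j) U) :
    ContDiffOn ℝ ∞ (fun z : 𝔼 n × 𝔼 n => ∑ j, a j z.1 * z.2 j) (U ×ˢ univ) :=
  ContDiffOn.sum fun j _ => (contDiffOn_comp_fst (ha j)).mul (contDiff_snd_apply j).contDiffOn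

variable (hU : IsOpen U)

include hU

lemma dy_linearForm {a : Fin n → (𝔼 n) → ℝ} (ha : ∀ j, ContDiffOn ℝ ∞ (a j) U) {z : 𝔼 n × 𝔼 n}
    (hz : z.1 ∈ U) (k : Fin n) : dy k (fun z => ∑ j, a j z.1 * z.2 j) z = a k z.1 := by
  have hd := fun j => differentiableAt_of_contDiffOn hU (ha j) hz
  rw [dy_eq_dirDeriv, dirDeriv_sum_dy_mul (hU.prod isOpen_univ)
    (fun j => contDiffOn_comp_fst (ha j)) ⟨hz, trivial⟩, sum_mul_single]
  simp only [← dy_eq_dirDeriv, dy_comp_fst (hd _)]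
  simp

lemma dx_linearForm {a : Fin n → (𝔼 n) → ℝ} (ha : ∀ j, ContDiffOn ℝ ∞ (a j) U) {z : 𝔼 n × 𝔼 n}
    (hz : z.1 ∈ U) (k : Fin n) :
    dx k (fun z => ∑ j, a j z.1 * z.2 j) z = ∑ j, pd k (a j) z.1 * z.2 j := by
  have hd := fun j => differentiableAt_of_contDiffOn hU (ha j) hz
  rw [dx_eq_dirDeriv, dirDeriv_sum_dy_mul (hU.prod isOpen_univ)
    (fun j => contDiffOn_comp_fst (ha j)) ⟨hz, trivial⟩]
  simp only [← dx_eq_dirDeriv, dx_comp_fst (hd _)]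
  simp

variable (hm : ∀ i j, ContDiffOn ℝ ∞ (fun x => m x i j) U)

include hm

omit hU in
lemma contDiffOn_quadraticLagrangian :
    ContDiffOn ℝ ∞ (quadraticLagrangian m) (U ×ˢ univ) :=
  ContDiffOn.sum fun i _ => (contDiffOn_linearForm (hm i)).mul (contDiff_snd_apply i).contDiffOn

lemma dx_quadraticLagrangian {z : 𝔼 n × 𝔼 n} (hz : z.1 ∈ U) (k : Fin n) :
    dx k (quadraticLagrangian m) z
      = ∑ i, (∑ j, pd k (fun x => m x i j) z.1 * z.2 j) * z.2 i := by
  have := dirDeriv_sum_dy_mul (hU.prod isOpen_univ) (fun i => contDiffOn_linearForm (hm i))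
    (z := z) ⟨hz, trivial⟩ (EuclideanSpace.single k 1, 0)
  simp only [← dx_eq_dirDeriv, dx_linearForm hU (hm _) hz, PiLp.zero_apply, mul_zero,
    Finset.sum_const_zero, add_zero] at this
  exact this

variable (hs : ∀ x ∈ U, (m x).IsSymm)

include hs

lemma dy_quadraticLagrangian {z : 𝔼 n × 𝔼 n} (hz : z.1 ∈ U) (l : Fin n) :
    dy l (quadraticLagrangian m) z = ∑ j, (2 * m z.1 l j) * z.2 j := by
  have := dirDeriv_sum_dy_mul (hU.prod isOpen_univ) (fun i => contDiffOn_linearForm (hm i))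
    (z := z) ⟨hz, trivial⟩ (0, EuclideanSpace.single l 1)
  rw [sum_mul_single] at this
  simp only [← dy_eq_dirDeriv, dy_linearForm hU (hm _) hz] at this
  change dy l (quadraticLagrangian m) z = _ at this
  rw [this, ← Finset.sum_add_distrib]
  refine Finset.sum_congr rfl fun j _ => ?_
  rw [(hs z.1 hz).apply l j]
  ring

lemma dx_dy_quadraticLagrangian {z : 𝔼 n × 𝔼 n} (hz : z.1 ∈ U) (k l : Fin n) :
    dx k (dy l (quadraticLagrangian m)) z = ∑ j, 2 * pd k (fun x => m x l j) z.1 * z.2 j := by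
  rw [dx_eq_dirDeriv, dirDeriv_congr (hU.prod isOpen_univ)
    (fun z hz => dy_quadraticLagrangian hU hm hs hz.1 l) (show z ∈ U ×ˢ univ from ⟨hz, trivial⟩), ← dx_eq_dirDeriv,
    dx_linearForm hU (fun j => contDiffOn_const.mul (hm l j)) hz]
  simp only [pd_eq_dirDeriv, dirDeriv_const_mul]

lemma dy_dy_quadraticLagrangian {z : 𝔼 n × 𝔼 n} (hz : z.1 ∈ U) (i l : Fin n) :
    dy i (dy l (quadraticLagrangian m)) z = 2 * m z.1 l i := by
  rw [dy_eq_dirDeriv, dirDeriv_congr (hU.prod isOpen_univ)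
    (fun z hz => dy_quadraticLagrangian hU hm hs hz.1 l) (show z ∈ U ×ˢ univ from ⟨hz, trivial⟩), ← dy_eq_dirDeriv,
    dy_linearForm hU (fun j => contDiffOn_const.mul (hm l j)) hz]

lemma dx_dy_dy_quadraticLagrangian {z : 𝔼 n × 𝔼 n} (hz : z.1 ∈ U) (k i l : Fin n) :
    dx k (dy i (dy l (quadraticLagrangian m))) z = 2 * pd k (fun x => m x l i) z.1 := by
  rw [dx_eq_dirDeriv, dirDeriv_congr (hU.prod isOpen_univ)
    (fun z hz => dy_dy_quadraticLagrangian hU hm hs hz.1 i l) (show z ∈ U ×ˢ univ from ⟨hz, trivial⟩), ← dx_eq_dirDeriv,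
    dx_comp_fst ((differentiableAt_of_contDiffOn hU (hm l i) hz).const_mul 2)]
  simp only [pd_eq_dirDeriv, dirDeriv_const_mul]

lemma dy_dy_dy_quadraticLagrangian {z : 𝔼 n × 𝔼 n} (hz : z.1 ∈ U) (j i l : Fin n) :
    dy j (dy i (dy l (quadraticLagrangian m))) z = 0 := by
  rw [dy_eq_dirDeriv, dirDeriv_congr (hU.prod isOpen_univ)
    (fun z hz => dy_dy_quadraticLagrangian hU hm hs hz.1 i l) (show z ∈ U ×ˢ univ from ⟨hz, trivial⟩), ← dy_eq_dirDeriv,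
    dy_comp_fst ((differentiableAt_of_contDiffOn hU (hm l i) hz).const_mul 2)]

lemma lagrangianHessian_quadraticLagrangian {z : 𝔼 n × 𝔼 n} (hz : z.1 ∈ U) :
    lagrangianHessian (quadraticLagrangian m) z = m z.1 := by
  ext i j
  simp only [lagrangianHessian, Matrix.of_apply, dy_dy_quadraticLagrangian hU hm hs hz]
  rw [(hs z.1 hz).apply i j]
  ring

/-- The contraction with `yʲ yᵏ` sees only the part symmetric in `j, k`, so the Euler–Lagrange
expression becomes a Christoffel symbol of the first kind. The factor `1/2` reflects the convention
`ẍ + 2G = 0`. -/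
lemma lagrangianSpray_quadraticLagrangian {z : 𝔼 n × 𝔼 n} (hz : z.1 ∈ U) (i : Fin n) :
    lagrangianSpray (quadraticLagrangian m) i z
      = (1 / 2) * ∑ j, (∑ k, matrixChristoffel m i j k z.1 * z.2 k) * z.2 j := by
  have key : ∀ l, (∑ k, (∑ j, 2 * pd k (fun x => m x l j) z.1 * z.2 j) * z.2 k)
      - ∑ i, (∑ j, pd l (fun x => m x i j) z.1 * z.2 j) * z.2 i
      = ∑ j, ∑ k, (pd j (fun x' => m x' l k) z.1 + pd k (fun x' => m x' l j) z.1
        - pd l (fun x' => m x' j k) z.1) * (z.2 k * z.2 j) := by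
    intro l
    have h : ∑ j, ∑ k, pd k (fun x' => m x' l j) z.1 * (z.2 k * z.2 j)
        = ∑ j, ∑ k, pd j (fun x' => m x' l k) z.1 * (z.2 k * z.2 j) := by
      rw [Finset.sum_comm]
      exact Finset.sum_congr rfl fun _ _ => Finset.sum_congr rfl fun _ _ => by ring
    simp only [sub_mul, add_mul, Finset.sum_add_distrib, Finset.sum_sub_distrib, h]
    simp only [Finset.sum_mul, ← Finset.sum_add_distrib, ← Finset.sum_sub_distrib]
    exact Finset.sum_congr rfl fun _ _ => Finset.sum_congr rfl fun _ _ => by ring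
  rw [lagrangianSpray]
  simp only [lagrangianHessian_quadraticLagrangian hU hm hs hz,
    dx_dy_quadraticLagrangian hU hm hs hz, dx_quadraticLagrangian hU hm hz]
  simp only [key, matrixChristoffel]
  simp only [Finset.mul_sum, Finset.sum_mul]
  rw [Finset.sum_comm]
  refine Finset.sum_congr rfl fun j _ => ?_
  rw [Finset.sum_comm]
  exact Finset.sum_congr rfl fun _ _ => Finset.sum_congr rfl fun _ _ => by ring

end Quadratic

/-! ### Curvature of quadratic sprays -/

section RiemannianCurvature

variable {m : (𝔼 n) → Matrix (Fin n) (Fin n) ℝ} {U : Set (𝔼 n)}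

/-- The curvature components of the Levi-Civita connection of a matrix-valued function. -/
def matrixCurvature (m : (𝔼 n) → Matrix (Fin n) (Fin n) ℝ) (l i j k : Fin n) (x : 𝔼 n) : ℝ :=
  pd i (matrixChristoffel m l j k) x - pd j (matrixChristoffel m l i k) x
    + (∑ p, matrixChristoffel m l i p x * matrixChristoffel m p j k x)
    - ∑ p, matrixChristoffel m l j p x * matrixChristoffel m p i k x

lemma matrixCurvature_swap (l i j k : Fin n) (x : 𝔼 n) :
    matrixCurvature m l i j k x = -matrixCurvature m l j i k x := by
  simp only [matrixCurvature]
  ring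

lemma pd_congr {f g : (𝔼 n) → ℝ} (hU : IsOpen U) (h : EqOn f g U) (k : Fin n) :
    EqOn (pd k f) (pd k g) U :=
  dirDeriv_congr hU h

lemma contDiffOn_pd {f : (𝔼 n) → ℝ} (hU : IsOpen U) (hf : ContDiffOn ℝ ∞ f U) (k : Fin n) :
    ContDiffOn ℝ ∞ (pd k f) U :=
  contDiffOn_dirDeriv hU hf _

lemma sprayRiemann_congr {G G' : Fin n → 𝔼 n × 𝔼 n → ℝ} {Ω : Set (𝔼 n × 𝔼 n)} (hΩ : IsOpen Ω)
    (h : ∀ i, EqOn (G i) (G' i) Ω) {z : 𝔼 n × 𝔼 n} (hz : z ∈ Ω) :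
    sprayRiemann G z = sprayRiemann G' z := by
  have h1 : ∀ i k, EqOn (dx k (G i)) (dx k (G' i)) Ω := fun i k => dirDeriv_congr hΩ (h i)
  have h2 : ∀ i k, EqOn (dy k (G i)) (dy k (G' i)) Ω := fun i k => dirDeriv_congr hΩ (h i)
  have h3 : ∀ i j k, dx j (dy k (G i)) z = dx j (dy k (G' i)) z :=
    fun i j k => dirDeriv_congr hΩ (h2 i k) hz
  have h4 : ∀ i j k, dy j (dy k (G i)) z = dy j (dy k (G' i)) z :=
    fun i j k => dirDeriv_congr hΩ (h2 i k) hz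
  ext i k
  simp only [sprayRiemann, Matrix.of_apply, h _ hz, h1 _ _ hz, h2 _ _ hz, h3, h4]

variable (hU : IsOpen U) (hm : ∀ i j, ContDiffOn ℝ ∞ (fun x => m x i j) U)
  (hs : ∀ x ∈ U, (m x).IsSymm) (hdet : ∀ x ∈ U, IsUnit (m x).det)

include hU hs in
lemma matrixChristoffel_symm {x : 𝔼 n} (hx : x ∈ U) (i j k : Fin n) :
    matrixChristoffel m i j k x = matrixChristoffel m i k j x := by
  simp only [matrixChristoffel]
  congr 1
  refine Finset.sum_congr rfl fun l _ => ?_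
  rw [pd_congr hU (f := fun x' => m x' j k) (g := fun x' => m x' k j)
    (fun x hx => (hs x hx).apply k j) l hx]
  ring

include hU hm hdet in
lemma contDiffOn_matrixChristoffel (i j k : Fin n) :
    ContDiffOn ℝ ∞ (matrixChristoffel m i j k) U :=
  contDiffOn_const.mul (ContDiffOn.sum fun l _ => (contDiffOn_inv_apply hm hdet i l).mul
    (((contDiffOn_pd hU (hm l k) j).add (contDiffOn_pd hU (hm l j) k)).sub
      (contDiffOn_pd hU (hm j k) l)))

include hU hm hs hdet

/-- The Riemann curvature of the spray of a quadratic Lagrangian is `v ↦ R(v, y) y`. -/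
lemma sprayRiemann_quadraticLagrangian {z : 𝔼 n × 𝔼 n} (hz : z.1 ∈ U) (i k : Fin n) :
    sprayRiemann (lagrangianSpray (quadraticLagrangian m)) z i k
      = ∑ a, ∑ b, matrixCurvature m i k a b z.1 * z.2 a * z.2 b := by
  -- Each `Gⁱ` is itself a quadratic form in `y`, with matrix `Γⁱ/2`, so the derivative formulas for
  -- quadratic Lagrangians apply to it too.
  let c : Fin n → (𝔼 n) → Matrix (Fin n) (Fin n) ℝ :=
    fun i x => Matrix.of fun j k => (1 / 2) * matrixChristoffel m i j k x
  have hc : ∀ i a b, ContDiffOn ℝ ∞ (fun x => c i x a b) U := fun i a b =>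
    contDiffOn_const.mul (contDiffOn_matrixChristoffel hU hm hdet i a b)
  have hcs : ∀ i, ∀ x ∈ U, (c i x).IsSymm := by
    intro i x hx
    ext a b
    simp only [c, Matrix.transpose_apply, Matrix.of_apply, matrixChristoffel_symm hU hs hx i a b]
  have hG : ∀ i, EqOn (lagrangianSpray (quadraticLagrangian m) i) (quadraticLagrangian (c i))
      (U ×ˢ univ) := by
    intro i z hz
    rw [lagrangianSpray_quadraticLagrangian hU hm hs hz.1]
    simp only [quadraticLagrangian, c, Matrix.of_apply, Finset.mul_sum, Finset.sum_mul, mul_assoc]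
  rw [sprayRiemann_congr (hU.prod isOpen_univ) hG (show z ∈ U ×ˢ univ from ⟨hz, trivial⟩)]
  simp only [sprayRiemann, Matrix.of_apply, dx_quadraticLagrangian hU (hc _) hz,
    dx_dy_quadraticLagrangian hU (hc _) (hcs _) hz, dy_quadraticLagrangian hU (hc _) (hcs _) hz,
    dy_dy_quadraticLagrangian hU (hc _) (hcs _) hz, quadraticLagrangian]
  simp only [c, Matrix.of_apply, pd_eq_dirDeriv, dirDeriv_const_mul]
  simp only [← pd_eq_dirDeriv, matrixCurvature, sub_mul, add_mul, Finset.sum_sub_distrib,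
    Finset.sum_add_distrib]
  -- The four terms of the spray formula match, in order, the four terms of the curvature tensor;
  -- the last one needs the symmetry of `Γ` in its lower indices.
  congr 1
  congr 1
  congr 1
  · simp only [Finset.mul_sum, Finset.sum_mul]
    exact Finset.sum_congr rfl fun _ _ => Finset.sum_congr rfl fun _ _ => by ring
  · simp only [Finset.mul_sum]
    exact Finset.sum_congr rfl fun _ _ => Finset.sum_congr rfl fun _ _ => by ring
  · simp only [Finset.mul_sum, Finset.sum_mul]
    rw [Finset.sum_comm]
    refine Finset.sum_congr rfl fun a _ => ?_
    rw [Finset.sum_comm]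
    exact Finset.sum_congr rfl fun _ _ => Finset.sum_congr rfl fun _ _ => by ring
  · have h : ∀ p, ∑ a, 2 * (1 / 2 * matrixChristoffel m i p a z.1) * z.2 a
        = ∑ a, matrixChristoffel m i a p z.1 * z.2 a := fun p =>
      Finset.sum_congr rfl fun a _ => by
        rw [matrixChristoffel_symm hU hs hz i p a]
        ring
    simp only [h, Finset.sum_mul]
    simp only [Finset.mul_sum]
    rw [Finset.sum_comm]
    refine Finset.sum_congr rfl fun a _ => ?_
    rw [Finset.sum_comm]
    exact Finset.sum_congr rfl fun _ _ => Finset.sum_congr rfl fun _ _ => by ring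

omit hU hm hs in
/-- The Christoffel symbols of the first kind. -/
lemma sum_mul_matrixChristoffel {x : 𝔼 n} (hx : x ∈ U) (l j k : Fin n) :
    ∑ p, m x l p * matrixChristoffel m p j k x
      = (1 / 2) * (pd j (fun x' => m x' l k) x + pd k (fun x' => m x' l j) x
        - pd l (fun x' => m x' j k) x) := by
  rw [← sum_mul_inv_mulVec (hdet x hx) (fun l => pd j (fun x' => m x' l k) x
    + pd k (fun x' => m x' l j) x - pd l (fun x' => m x' j k) x) l, Finset.mul_sum]
  exact Finset.sum_congr rfl fun p _ => by rw [matrixChristoffel]; ring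

omit hs in
lemma sum_mul_pd_matrixChristoffel {x : 𝔼 n} (hx : x ∈ U) (l i j k : Fin n) :
    ∑ p, m x l p * pd i (matrixChristoffel m p j k) x
      = (1 / 2) * (pd i (pd j (fun x' => m x' l k)) x + pd i (pd k (fun x' => m x' l j)) x
        - pd i (pd l (fun x' => m x' j k)) x)
        - ∑ p, pd i (fun x' => m x' l p) x * matrixChristoffel m p j k x := by
  have h := pd_congr hU (fun x hx => sum_mul_matrixChristoffel hdet hx l j k) i hx
  have hd : ∀ a b c, DifferentiableAt ℝ (pd a (fun x' => m x' b c)) x := fun a b c =>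
    differentiableAt_of_contDiffOn hU (contDiffOn_pd hU (hm b c) a) hx
  rw [pd_eq_dirDeriv i, dirDeriv_sum_mul (fun p => differentiableAt_of_contDiffOn hU (hm l p) hx)
    (fun p => differentiableAt_of_contDiffOn hU (contDiffOn_matrixChristoffel hU hm hdet p j k) hx),
    dirDeriv_const_mul, dirDeriv_sub (DifferentiableAt.fun_add (hd _ _ _) (hd _ _ _)) (hd _ _ _),
    dirDeriv_add (hd _ _ _) (hd _ _ _)] at h
  simp only [pd_eq_dirDeriv] at *
  linarith

/-- Lowering the index turns the curvature into second derivatives of the metric plus terms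
quadratic in `Γ`, a form in which the antisymmetry in `l` and `k` can be read off. -/
lemma sum_mul_matrixCurvature {x : 𝔼 n} (hx : x ∈ U) (l i j k : Fin n) :
    ∑ p, m x l p * matrixCurvature m p i j k x
      = (1 / 2) * (pd i (pd k (fun x' => m x' l j)) x - pd i (pd l (fun x' => m x' j k)) x
          - pd j (pd k (fun x' => m x' l i)) x + pd j (pd l (fun x' => m x' i k)) x)
        - ∑ p, ∑ q, m x p q * matrixChristoffel m q i l x * matrixChristoffel m p j k x
        + ∑ p, ∑ q, m x p q * matrixChristoffel m q j l x * matrixChristoffel m p i k x := by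
  -- This is `∇g = 0`. Substituted into the derivative of the lowered `Γ`, one of its two terms
  -- cancels the quadratic part of the curvature and the other remains.
  have hmet : ∀ a b c, pd a (fun x' => m x' b c) x = ∑ p, m x b p * matrixChristoffel m p a c x
      + ∑ p, m x c p * matrixChristoffel m p a b x := by
    intro a b c
    have e : ∀ b c, EqOn (fun x' => m x' b c) (fun x' => m x' c b) U :=
      fun b c x hx => (hs x hx).apply c b
    rw [sum_mul_matrixChristoffel hdet hx, sum_mul_matrixChristoffel hdet hx,
      pd_congr hU (e c b) a hx, pd_congr hU (e c a) b hx, pd_congr hU (e b a) c hx]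
    ring
  have hij : pd i (pd j (fun x' => m x' l k)) x = pd j (pd i (fun x' => m x' l k)) x :=
    dirDeriv_comm hU (hm l k) hx _ _
  have hquad : ∀ i j, ∑ p, m x l p * ∑ q, matrixChristoffel m p i q x * matrixChristoffel m q j k x
      = ∑ q, (∑ p, m x l p * matrixChristoffel m p i q x) * matrixChristoffel m q j k x := by
    intro i j
    simp only [Finset.mul_sum, Finset.sum_mul]
    rw [Finset.sum_comm]
    exact Finset.sum_congr rfl fun _ _ => Finset.sum_congr rfl fun _ _ => by ring
  simp only [matrixCurvature, mul_sub, mul_add, Finset.sum_sub_distrib, Finset.sum_add_distrib,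
    sum_mul_pd_matrixChristoffel hU hm hdet hx, hquad, hij, hmet, add_mul, ← Finset.sum_mul]
  ring

/-- Metric compatibility: `g(R(u, v) w, z)` is antisymmetric in `w` and `z`. -/
lemma sum_mul_matrixCurvature_swap {x : 𝔼 n} (hx : x ∈ U) (l i j k : Fin n) :
    ∑ p, m x l p * matrixCurvature m p i j k x = -∑ p, m x k p * matrixCurvature m p i j l x := by
  have e : ∀ b c, EqOn (fun x' => m x' b c) (fun x' => m x' c b) U :=
    fun b c x hx => (hs x hx).apply c b
  have e2 : ∀ a a' b c, pd a (pd a' (fun x' => m x' b c)) x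
      = pd a (pd a' (fun x' => m x' c b)) x :=
    fun a a' b c => pd_congr hU (pd_congr hU (e b c) a') a hx
  have hq : ∀ i j k l,
      ∑ p, ∑ q, m x p q * matrixChristoffel m q i l x * matrixChristoffel m p j k x
      = ∑ p, ∑ q, m x p q * matrixChristoffel m q j k x * matrixChristoffel m p i l x := by
    intro i j k l
    rw [Finset.sum_comm]
    refine Finset.sum_congr rfl fun p _ => Finset.sum_congr rfl fun q _ => ?_
    rw [(hs x hx).apply p q]
    ring
  rw [sum_mul_matrixCurvature hU hm hs hdet hx, sum_mul_matrixCurvature hU hm hs hdet hx,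
    hq i j k l, hq j i k l, e2 i k j l, e2 i l j k, e2 j k i l, e2 j l i k]
  ring

end RiemannianCurvature

/-! ### Comparison of a Lagrangian with its localization along a vector field -/

section Comparison

/-- The failure of `V` to be a geodesic field: `∂_k Vⁱ Vᵏ + 2 Gⁱ(x, V)`. -/
def geodesicDefect (G : Fin n → 𝔼 n × 𝔼 n → ℝ) (V : (𝔼 n) → 𝔼 n) (i : Fin n) (x : 𝔼 n) : ℝ :=
  ∑ k, V x k * pd k (fun x => V x i) x + 2 * G i (x, V x)

/-- The localization `g_{ij}(x, V x)` of the Hessian of `L` along `V`. -/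
def localizedHessian (L : 𝔼 n × 𝔼 n → ℝ) (V : (𝔼 n) → 𝔼 n) (x : 𝔼 n) : Matrix (Fin n) (Fin n) ℝ :=
  lagrangianHessian L (x, V x)

variable {U : Set (𝔼 n)} {Ω : Set (𝔼 n × 𝔼 n)} {V : (𝔼 n) → 𝔼 n}

/-- The curvature of a spray at a point where `V` is geodesic. -/
lemma sprayRiemann_section (hΩ : IsOpen Ω) {G : Fin n → 𝔼 n × 𝔼 n → ℝ}
    (hG : ∀ i, ContDiffOn ℝ ∞ (G i) Ω) {x : 𝔼 n} (hx : (x, V x) ∈ Ω) (hV : DifferentiableAt ℝ V x)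
    (hZ : ∀ i, geodesicDefect G V i x = 0) (i k : Fin n) :
    sprayRiemann G (x, V x) i k =
      2 * pd k (fun x => G i (x, V x)) x - 2 * ∑ l, dy l (G i) (x, V x) * pd k (fun x => V x l) x
        - ∑ j, V x j * pd j (fun x => dy k (G i) (x, V x)) x
        - ∑ j, dy j (G i) (x, V x) * dy k (G j) (x, V x) := by
  have h1 := pd_comp_section (differentiableAt_of_contDiffOn hΩ (hG i) hx) hV
  have h2 := pd_comp_section
    (differentiableAt_of_contDiffOn hΩ (contDiffOn_dy hΩ (hG i) k) hx) hV
  -- The geodesic equation replaces `Vʲ ∂_j Vˡ` by `-2Gˡ`, so the second fibre derivatives in the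
  -- curvature are absorbed into the derivative of `∂Gⁱ/∂yᵏ` along `V`.
  have h3 : ∑ j, V x j * ∑ l, dy l (dy k (G i)) (x, V x) * pd j (fun x => V x l) x
      = - 2 * ∑ j, G j (x, V x) * dy j (dy k (G i)) (x, V x) := by
    simp only [Finset.mul_sum]
    rw [Finset.sum_comm]
    refine Finset.sum_congr rfl fun l _ => ?_
    have : ∑ k, V x k * pd k (fun x => V x l) x = -(2 * G l (x, V x)) := by
      have := hZ l
      rw [geodesicDefect] at this
      linarith
    calc _ = dy l (dy k (G i)) (x, V x) * ∑ j, V x j * pd j (fun x => V x l) x := by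
          rw [Finset.mul_sum]
          exact Finset.sum_congr rfl fun _ _ => by ring
      _ = _ := by rw [this]; ring
  simp only [h1, h2, mul_add, Finset.sum_add_distrib, h3, sprayRiemann, Matrix.of_apply]
  ring

variable {L : 𝔼 n × 𝔼 n → ℝ} (hΩ : IsOpen Ω) (hL : ContDiffOn ℝ ∞ L Ω)
  (hE : ∀ z ∈ Ω, ∑ l, dy l L z * z.2 l = 2 * L z)
  (hU : IsOpen U) (hV : ContDiffOn ℝ ∞ V U) (hVΩ : ∀ x ∈ U, (x, V x) ∈ Ω)

include hΩ hL hU hV hVΩ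

omit hU in
lemma contDiffOn_localizedHessian (i j : Fin n) :
    ContDiffOn ℝ ∞ (fun x => localizedHessian L V x i j) U :=
  (contDiffOn_lagrangianHessian hΩ hL i j).comp (contDiffOn_id.prodMk hV) fun x hx => hVΩ x hx

omit hU hV in
lemma localizedHessian_isSymm : ∀ x ∈ U, (localizedHessian L V x).IsSymm := by
  intro x hx
  ext i j
  simp only [localizedHessian, lagrangianHessian, Matrix.transpose_apply, Matrix.of_apply,
    dy_dy_comm hΩ hL (hVΩ x hx) i j]

/-- Chain rule along the section: the second term is what distinguishes differentiating the frozen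
Hessian from freezing the differentiated one. -/
lemma pd_localizedHessian {x : 𝔼 n} (hx : x ∈ U) (k i j : Fin n) :
    2 * pd k (fun x => localizedHessian L V x i j) x = dx k (dy i (dy j L)) (x, V x)
      + ∑ l, dy l (dy i (dy j L)) (x, V x) * pd k (fun x => V x l) x := by
  have hVx : DifferentiableAt ℝ V x :=
    (hV.contDiffAt (hU.mem_nhds hx)).differentiableAt (by simp)
  rw [← pd_comp_section (f := dy i (dy j L)) (differentiableAt_of_contDiffOn hΩ
    (contDiffOn_dy hΩ (contDiffOn_dy hΩ hL j) i) (hVΩ x hx)) hVx]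
  simp only [localizedHessian, lagrangianHessian, Matrix.of_apply, pd_eq_dirDeriv,
    dirDeriv_const_mul]
  ring

include hE

/-- Contraction with `V` removes the chain-rule term, because the third fibre derivatives at `(x, V
x)` annihilate `V x`. No geodesic condition is needed here. -/
lemma sum_pd_localizedHessian_mul {x : 𝔼 n} (hx : x ∈ U) (k i : Fin n) :
    ∑ j, 2 * pd k (fun x => localizedHessian L V x i j) x * V x j = dx k (dy i L) (x, V x) := by
  have h1 := sum_dx_dy_dy_mul hΩ hL hE (hVΩ x hx) k i
  have h2 : ∑ j, (∑ l, dy l (dy i (dy j L)) (x, V x) * pd k (fun x => V x l) x) * V x j = 0 := by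
    simp only [Finset.sum_mul]
    rw [Finset.sum_comm]
    refine Finset.sum_eq_zero fun l _ => ?_
    have h3 := sum_dy_dy_dy_mul hΩ hL hE (hVΩ x hx) l i
    calc _ = (∑ j, dy l (dy i (dy j L)) (x, V x) * V x j) * pd k (fun x => V x l) x := by
          rw [Finset.sum_mul]
          exact Finset.sum_congr rfl fun _ _ => by ring
      _ = 0 := by rw [h3, zero_mul]
  simp only [pd_localizedHessian hΩ hL hU hV hVΩ hx, add_mul, Finset.sum_add_distrib, h1, h2,
    add_zero]

lemma dx_dy_localized {x : 𝔼 n} (hx : x ∈ U) (k i : Fin n) :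
    dx k (dy i (quadraticLagrangian (localizedHessian L V))) (x, V x) = dx k (dy i L) (x, V x) := by
  rw [dx_dy_quadraticLagrangian hU (contDiffOn_localizedHessian hΩ hL hV hVΩ)
    (localizedHessian_isSymm hΩ hL hVΩ) hx, sum_pd_localizedHessian_mul hΩ hL hE hU hV hVΩ hx]

/-- A second contraction with `V`, followed by Euler's identity differentiated in `x`. -/
lemma dx_localized {x : 𝔼 n} (hx : x ∈ U) (k : Fin n) :
    dx k (quadraticLagrangian (localizedHessian L V)) (x, V x) = dx k L (x, V x) := by
  have h1 := sum_dx_dy_mul hΩ hL hE (hVΩ x hx) k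
  simp only [← sum_pd_localizedHessian_mul hΩ hL hE hU hV hVΩ hx] at h1
  rw [dx_quadraticLagrangian hU (contDiffOn_localizedHessian hΩ hL hV hVΩ) hx]
  simp only [mul_assoc, ← Finset.mul_sum] at h1
  simpa [← mul_assoc] using h1

/-- Along `V`, the sprays of `L` and of its localization agree. -/
lemma lagrangianSpray_localized {x : 𝔼 n} (hx : x ∈ U) (i : Fin n) :
    lagrangianSpray (quadraticLagrangian (localizedHessian L V)) i (x, V x)
      = lagrangianSpray L i (x, V x) := by
  simp only [lagrangianSpray, lagrangianHessian_quadraticLagrangian hU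
    (contDiffOn_localizedHessian hΩ hL hV hVΩ) (localizedHessian_isSymm hΩ hL hVΩ)
    (z := (x, V x)) hx, dx_dy_localized hΩ hL hE hU hV hVΩ hx, dx_localized hΩ hL hE hU hV hVΩ hx]
  rfl

variable (hdet : ∀ z ∈ Ω, IsUnit (lagrangianHessian L z).det)

include hdet

/-- At points where `V` is geodesic, the nonlinear connections of `L` and of its localization
agree along `V`. -/
lemma dy_lagrangianSpray_localized {x : 𝔼 n} (hx : x ∈ U)
    (hZ : ∀ i, geodesicDefect (lagrangianSpray L) V i x = 0) (i j : Fin n) :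
    dy j (lagrangianSpray (quadraticLagrangian (localizedHessian L V)) i) (x, V x)
      = dy j (lagrangianSpray L i) (x, V x) := by
  have hm := contDiffOn_localizedHessian hΩ hL hV hVΩ
  have hs := localizedHessian_isSymm hΩ hL hVΩ
  have hH : ∀ i l, dy i (dy l (quadraticLagrangian (localizedHessian L V))) (x, V x)
      = dy i (dy l L) (x, V x) := by
    intro i l
    rw [dy_dy_quadraticLagrangian hU hm hs hx, dy_dy_comm hΩ hL (hVΩ x hx)]
    simp [localizedHessian, lagrangianHessian]
  have hdet' : ∀ z ∈ U ×ˢ univ, IsUnit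
      (lagrangianHessian (quadraticLagrangian (localizedHessian L V)) z).det := by
    intro z hz
    rw [lagrangianHessian_quadraticLagrangian hU hm hs hz.1]
    exact hdet _ (hVΩ _ hz.1)
  have h1 := sum_dy_dy_mul_dy_lagrangianSpray hΩ hL hdet (hVΩ x hx)
  have h2 := sum_dy_dy_mul_dy_lagrangianSpray (hU.prod isOpen_univ)
    (contDiffOn_quadraticLagrangian hm) hdet' (show (x, V x) ∈ U ×ˢ univ from ⟨hx, trivial⟩)
  -- The chain-rule term is now contracted in its derivative index. It survives, and the geodesic
  -- equation identifies it with the cubic term in the relation for `L`.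
  have h3 : ∀ i j, ∑ k, dx k (dy j (dy i (quadraticLagrangian (localizedHessian L V)))) (x, V x)
        * V x k
      = ∑ k, dx k (dy j (dy i L)) (x, V x) * V x k
        - 2 * ∑ l, dy j (dy i (dy l L)) (x, V x) * lagrangianSpray L l (x, V x) := by
    intro i j
    have h4 : ∑ k, (∑ l, dy l (dy i (dy j L)) (x, V x) * pd k (fun x => V x l) x) * V x k
        = - 2 * ∑ l, dy j (dy i (dy l L)) (x, V x) * lagrangianSpray L l (x, V x) := by
      simp only [Finset.sum_mul, Finset.mul_sum]
      rw [Finset.sum_comm]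
      refine Finset.sum_congr rfl fun l _ => ?_
      -- Total symmetry of the third derivatives, obtained from adjacent transpositions.
      have e1 : dy l (dy i (dy j L)) (x, V x) = dy j (dy i (dy l L)) (x, V x) := by
        have a1 : ∀ i l, EqOn (dy i (dy l L)) (dy l (dy i L)) Ω :=
          fun i l z hz => dy_dy_comm hΩ hL hz i l
        have a2 : ∀ p i l, dy p (dy i (dy l L)) (x, V x) = dy p (dy l (dy i L)) (x, V x) :=
          fun p i l => dirDeriv_congr hΩ (a1 i l) (hVΩ x hx)
        have a3 : ∀ p i l, dy p (dy i (dy l L)) (x, V x) = dy i (dy p (dy l L)) (x, V x) :=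
          fun p i l => dy_dy_comm hΩ (contDiffOn_dy hΩ hL l) (hVΩ x hx) p i
        exact (a3 l i j).trans ((a2 i l j).trans (a3 i j l))
      have e2 : ∑ k, V x k * pd k (fun x => V x l) x = -(2 * lagrangianSpray L l (x, V x)) := by
        have := hZ l
        rw [geodesicDefect] at this
        linarith
      calc _ = dy l (dy i (dy j L)) (x, V x) * ∑ k, V x k * pd k (fun x => V x l) x := by
            rw [Finset.mul_sum]
            exact Finset.sum_congr rfl fun _ _ => by ring
        _ = _ := by rw [e2, e1]; ring
    have h5 : ∀ k, dx k (dy j (dy i (quadraticLagrangian (localizedHessian L V)))) (x, V x)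
        = dx k (dy i (dy j L)) (x, V x)
          + ∑ l, dy l (dy i (dy j L)) (x, V x) * pd k (fun x => V x l) x := fun k => by
      rw [dx_dy_dy_quadraticLagrangian hU hm hs hx, pd_localizedHessian hΩ hL hU hV hVΩ hx]
    have h6 : ∀ k, dx k (dy i (dy j L)) (x, V x) = dx k (dy j (dy i L)) (x, V x) := fun k =>
      dirDeriv_congr hΩ (fun z hz => dy_dy_comm hΩ hL hz i j) (hVΩ x hx)
    simp only [h5, h6, add_mul, Finset.sum_add_distrib]
    rw [h4]
    ring
  -- Both families of connection coefficients now solve the same linear system; invertibility of the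
  -- Hessian identifies them.
  have key := eq_of_sum_mul_eq (hdet _ (hVΩ x hx))
    (b := fun l => dy j (lagrangianSpray (quadraticLagrangian (localizedHessian L V)) l) (x, V x))
    (c := fun l => dy j (lagrangianSpray L l) (x, V x)) (fun i => by
      have h1 := h1 i j
      have h2 := h2 i j
      simp only [h3, hH, dx_dy_localized hΩ hL hE hU hV hVΩ hx,
        dy_dy_dy_quadraticLagrangian hU hm hs (z := (x, V x)) hx] at h2
      simp only [lagrangianHessian, Matrix.of_apply, mul_assoc, ← Finset.mul_sum]
      rw [h1, h2]
      simp
      ring)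
  exact congrFun key i

/-- The curvatures of `L` and of its localization along `V` agree at a point whose integral curve
of `V` is a geodesic. -/
theorem sprayRiemann_localized {c : ℝ → 𝔼 n}
    (hc : ∀ᶠ t in nhds (0 : ℝ), c t ∈ U ∧ HasDerivAt c (V (c t)) t ∧
      ∀ i, geodesicDefect (lagrangianSpray L) V i (c t) = 0) :
    sprayRiemann (lagrangianSpray L) (c 0, V (c 0))
      = sprayRiemann (lagrangianSpray (quadraticLagrangian (localizedHessian L V)))
          (c 0, V (c 0)) := by
  obtain ⟨h0U, h0d, h0Z⟩ := hc.self_of_nhds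
  have hm := contDiffOn_localizedHessian hΩ hL hV hVΩ
  have hs := localizedHessian_isSymm hΩ hL hVΩ
  have hdet' : ∀ z ∈ U ×ˢ univ, IsUnit
      (lagrangianHessian (quadraticLagrangian (localizedHessian L V)) z).det := by
    intro z hz
    rw [lagrangianHessian_quadraticLagrangian hU hm hs hz.1]
    exact hdet _ (hVΩ _ hz.1)
  have hΩ' : IsOpen (U ×ˢ (univ : Set (𝔼 n))) := hU.prod isOpen_univ
  have hG := contDiffOn_lagrangianSpray hΩ hL hdet
  have hG' := contDiffOn_lagrangianSpray hΩ' (contDiffOn_quadraticLagrangian hm) hdet'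
  have hVx : DifferentiableAt ℝ V (c 0) :=
    (hV.contDiffAt (hU.mem_nhds h0U)).differentiableAt (by simp)
  have hspray := fun (x) (hx : x ∈ U) => lagrangianSpray_localized hΩ hL hE hU hV hVΩ hx
  -- The defect depends on the spray only through its values along `V`, so `V` is geodesic for the
  -- localization too.
  have hZ' : ∀ i, geodesicDefect
      (lagrangianSpray (quadraticLagrangian (localizedHessian L V))) V i (c 0) = 0 := by
    intro i
    have := h0Z i
    rwa [geodesicDefect, ← hspray _ h0U, ← geodesicDefect] at this
  have hN := fun (x) (hx : x ∈ U) (hZ : ∀ i, geodesicDefect (lagrangianSpray L) V i x = 0) =>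
    dy_lagrangianSpray_localized hΩ hL hE hU hV hVΩ hdet hx hZ
  ext i k
  rw [sprayRiemann_section hΩ hG (hVΩ _ h0U) hVx h0Z,
    sprayRiemann_section hΩ' hG' ⟨h0U, trivial⟩ hVx hZ']
  -- The sprays agree along `V` on an open set, hence so do all partial derivatives.
  have e1 : pd k (fun x => lagrangianSpray (quadraticLagrangian (localizedHessian L V)) i (x, V x))
      (c 0) = pd k (fun x => lagrangianSpray L i (x, V x)) (c 0) :=
    pd_congr hU (fun x hx => hspray x hx i) k h0U
  -- The connections are known to agree only on the curve, but this sum is the derivative in the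
  -- direction `V = ċ` and so is determined by the values there.
  have e2 : ∑ j, V (c 0) j * pd j (fun x => dy k (lagrangianSpray
        (quadraticLagrangian (localizedHessian L V)) i) (x, V x)) (c 0)
      = ∑ j, V (c 0) j * pd j (fun x => dy k (lagrangianSpray L i) (x, V x)) (c 0) := by
    have s : ContDiffOn ℝ ∞ (fun x => (x, V x)) U := contDiffOn_id.prodMk hV
    have d1 := deriv_comp_eq_sum_pd (differentiableAt_of_contDiffOn hU
      ((contDiffOn_dy hΩ (hG i) k).comp s hVΩ) h0U) h0d
    have d2 := deriv_comp_eq_sum_pd (differentiableAt_of_contDiffOn hU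
      ((contDiffOn_dy hΩ' (hG' i) k).comp s fun x hx => ⟨hx, trivial⟩) h0U) h0d
    refine d2.unique (d1.congr_of_eventuallyEq ?_)
    filter_upwards [hc] with t ht using hN _ ht.1 ht.2.2 i k
  rw [e1, e2]
  simp only [hN _ h0U h0Z]

end Comparison

/-! ### Second derivatives in the fibre directions -/

lemma deriv_deriv_fibre {Ω : Set (𝔼 n × 𝔼 n)} (hΩ : IsOpen Ω) {L : 𝔼 n × 𝔼 n → ℝ}
    (hL : ContDiffOn ℝ ∞ L Ω) {x y : 𝔼 n} (hz : (x, y) ∈ Ω) (u v : 𝔼 n) :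
    deriv (fun s : ℝ => deriv (fun t : ℝ => L (x, y + s • u + t • v)) 0) 0
      = ∑ i, ∑ j, dy i (dy j L) (x, y) * u i * v j := by
  have hline : ∀ (f : 𝔼 n × 𝔼 n → ℝ), ContDiffOn ℝ ∞ f Ω → ∀ y w : 𝔼 n, (x, y) ∈ Ω →
      HasDerivAt (fun t : ℝ => f (x, y + t • w)) (∑ j, dy j f (x, y) * w j) 0 := by
    intro f hf y w hy
    have h1 : HasDerivAt (fun t : ℝ => (x, y + t • w)) (0, w) 0 := by
      have := (hasDerivAt_const (0 : ℝ) x).prodMk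
        (((hasDerivAt_id (0 : ℝ)).smul_const w).const_add y)
      simpa using this
    have h0 : ((x, y + (0 : ℝ) • w) : 𝔼 n × 𝔼 n) = (x, y) := by simp
    have hd : HasFDerivAt f (fderiv ℝ f (x, y)) (x, y + (0 : ℝ) • w) := by
      rw [h0]
      exact (differentiableAt_of_contDiffOn hΩ hf hy).hasFDerivAt
    have h2 := hd.comp_hasDerivAt (0 : ℝ) h1
    rw [clm_prod_apply_eq_sum] at h2
    simpa [dy, Function.comp_def] using h2
  -- The inner derivative can be evaluated only while the base vector stays in `Ω`; for `F²` this
  -- means off the zero section.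
  have hev : ∀ᶠ s : ℝ in nhds 0, (x, y + s • u) ∈ Ω := by
    have hc : Continuous fun s : ℝ => ((x, y + s • u) : 𝔼 n × 𝔼 n) := by fun_prop
    exact hc.continuousAt.preimage_mem_nhds (hΩ.mem_nhds (by simpa using hz))
  have h1 : (fun s : ℝ => deriv (fun t : ℝ => L (x, y + s • u + t • v)) 0)
      =ᶠ[nhds 0] fun s => ∑ j, dy j L (x, y + s • u) * v j := by
    filter_upwards [hev] with s hs using (hline L hL _ v hs).deriv
  rw [h1.deriv_eq]
  have h2 := HasDerivAt.fun_sum (u := Finset.univ) fun j _ =>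
    (hline (dy j L) (contDiffOn_dy hΩ hL j) y u hz).mul_const (v j)
  rw [h2.deriv, Finset.sum_comm]
  simp only [Finset.sum_mul]

/-- A kernel vector would be null for the quadratic form; symmetry plays no role. -/
lemma isUnit_det_of_pos {ι : Type*} [Fintype ι] [DecidableEq ι] {A : Matrix ι ι ℝ}
    (h : ∀ v : ι → ℝ, v ≠ 0 → 0 < ∑ i, ∑ j, A i j * v i * v j) : IsUnit A.det := by
  rw [isUnit_iff_ne_zero]
  intro h0
  obtain ⟨v, hv, hAv⟩ := Matrix.exists_mulVec_eq_zero_iff.2 h0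
  refine (h v hv).ne' (Finset.sum_eq_zero fun i _ => ?_)
  have : ∑ j, A i j * v j = 0 := congrFun hAv i
  calc _ = v i * ∑ j, A i j * v j := by
        rw [Finset.mul_sum]
        exact Finset.sum_congr rfl fun _ _ => by ring
    _ = 0 := by rw [this, mul_zero]

lemma lagrangianSpray_congr {Ω : Set (𝔼 n × 𝔼 n)} (hΩ : IsOpen Ω) {L L' : 𝔼 n × 𝔼 n → ℝ}
    (h : EqOn L L' Ω) (i : Fin n) : EqOn (lagrangianSpray L i) (lagrangianSpray L' i) Ω := by
  intro z hz
  have h1 : ∀ k, EqOn (dx k L) (dx k L') Ω := fun k => dirDeriv_congr hΩ h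
  have h2 : ∀ k, EqOn (dy k L) (dy k L') Ω := fun k => dirDeriv_congr hΩ h
  have h3 : ∀ j k, dx j (dy k L) z = dx j (dy k L') z := fun j k => dirDeriv_congr hΩ (h2 k) hz
  have h4 : ∀ j k, dy j (dy k L) z = dy j (dy k L') z := fun j k => dirDeriv_congr hΩ (h2 k) hz
  simp only [lagrangianSpray, lagrangianHessian, h1 _ hz, h3, h4]

lemma matrixChristoffel_congr {U : Set (𝔼 n)} (hU : IsOpen U)
    {m m' : (𝔼 n) → Matrix (Fin n) (Fin n) ℝ} (h : EqOn m m' U) (i j k : Fin n) :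
    EqOn (matrixChristoffel m i j k) (matrixChristoffel m' i j k) U := by
  intro x hx
  have h1 : ∀ a b c, pd c (fun x => m x a b) x = pd c (fun x => m' x a b) x := fun a b c =>
    pd_congr hU (fun x hx => by simp only [h hx]) c hx
  simp only [matrixChristoffel, h hx, h1]

lemma matrixCurvature_congr {U : Set (𝔼 n)} (hU : IsOpen U)
    {m m' : (𝔼 n) → Matrix (Fin n) (Fin n) ℝ} (h : EqOn m m' U) {x : 𝔼 n} (hx : x ∈ U)
    (l i j k : Fin n) : matrixCurvature m l i j k x = matrixCurvature m' l i j k x := by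
  have h1 := matrixChristoffel_congr hU h
  have h2 : ∀ c i j k, pd c (matrixChristoffel m i j k) x = pd c (matrixChristoffel m' i j k) x :=
    fun c i j k => pd_congr hU (h1 i j k) c hx
  simp only [matrixCurvature, h1 _ _ _ hx, h2]

/-! ### Charts -/

section Charts

lemma contMDiff_tangentBundle_mk : ContMDiff 𝓘(ℝ, (𝔼 n) × 𝔼 n) (𝓡 n).tangent ∞
    (fun z : 𝔼 n × 𝔼 n => (⟨z.1, z.2⟩ : TangentBundle (𝓡 n) (𝔼 n))) := by
  intro z
  refine Bundle.contMDiffAt_totalSpace.2 ⟨contDiff_fst.contMDiff.contMDiffAt, ?_⟩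
  have : ContMDiffAt 𝓘(ℝ, (𝔼 n) × 𝔼 n) 𝓘(ℝ, 𝔼 n) ∞ (fun z : 𝔼 n × 𝔼 n => z.2) z :=
    contDiff_snd.contMDiff.contMDiffAt
  refine this.congr_of_eventuallyEq (Filter.Eventually.of_forall fun w => ?_)
  change (trivializationAt (𝔼 n) (TangentSpace (𝓡 n)) z.1
    (⟨w.1, w.2⟩ : TangentBundle (𝓡 n) (𝔼 n))).2 = w.2
  simp

variable {M : Type*} [TopologicalSpace M] [ChartedSpace (EuclideanSpace ℝ (Fin n)) M]
  {e : OpenPartialHomeomorph M (EuclideanSpace ℝ (Fin n))}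

lemma mdifferentiable_of_mem_maximalAtlas (he : e ∈ IsManifold.maximalAtlas (𝓡 n) ∞ M) :
    e.MDifferentiable (𝓡 n) (𝓡 n) :=
  ⟨(contMDiffOn_of_mem_maximalAtlas he).mdifferentiableOn (by simp),
    (contMDiffOn_symm_of_mem_maximalAtlas he).mdifferentiableOn (by simp)⟩

variable (he : e ∈ IsManifold.maximalAtlas (𝓡 n) ∞ M)

include he

lemma isInvertible_coords {p : M} (hp : p ∈ e.source) : (coords e p).IsInvertible :=
  ⟨(mdifferentiable_of_mem_maximalAtlas he).mfderiv hp, rfl⟩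

lemma ofCoords_coords {p : M} (hp : p ∈ e.source) (v : TangentSpace (𝓡 n) p) :
    ofCoords e p (coords e p v) = v := by
  obtain ⟨A, hA⟩ := isInvertible_coords he hp
  rw [ofCoords, ← hA, ContinuousLinearMap.inverse_equiv]
  exact A.symm_apply_apply v

lemma coords_ofCoords {p : M} (hp : p ∈ e.source) (a : 𝔼 n) :
    coords e p (ofCoords e p a) = a := by
  obtain ⟨A, hA⟩ := isInvertible_coords he hp
  rw [ofCoords, ← hA, ContinuousLinearMap.inverse_equiv]
  exact A.apply_symm_apply a

lemma mfderiv_symm_eq_ofCoords {x : 𝔼 n} (hx : x ∈ e.target) (a : 𝔼 n) :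
    mfderiv (𝓡 n) (𝓡 n) e.symm x a = ofCoords e (e.symm x) a := by
  have h := (mdifferentiable_of_mem_maximalAtlas he).comp_symm_deriv hx
  have h1 : coords e (e.symm x) (mfderiv (𝓡 n) (𝓡 n) e.symm x a) = a :=
    congrArg (fun A : (𝔼 n) →L[ℝ] 𝔼 n => A a) h
  rw [← ofCoords_coords he (e.map_target hx) (mfderiv (𝓡 n) (𝓡 n) e.symm x a), h1]

lemma sqInChart_eq (F : TangentBundle (𝓡 n) M → ℝ) {x : 𝔼 n} (hx : x ∈ e.target) (a : 𝔼 n) :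
    sqInChart F e (x, a) = F ⟨e.symm x, ofCoords e (e.symm x) a⟩ ^ 2 := by
  rw [← mfderiv_symm_eq_ofCoords he hx]
  rfl

lemma ofCoords_ne_zero {p : M} (hp : p ∈ e.source) {a : 𝔼 n} (ha : a ≠ 0) :
    ofCoords e p a ≠ 0 := by
  intro h
  rw [← coords_ofCoords he hp a, h, map_zero] at ha
  exact ha rfl

lemma coords_ne_zero {p : M} (hp : p ∈ e.source) {v : TangentSpace (𝓡 n) p} (hv : v ≠ 0) :
    coords e p v ≠ 0 := by
  intro h
  rw [← ofCoords_coords he hp v, h, map_zero] at hv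
  exact hv rfl

omit [ChartedSpace (𝔼 n) M] he in
lemma isOpen_slit (e : OpenPartialHomeomorph M (EuclideanSpace ℝ (Fin n))) :
    IsOpen (e.target ×ˢ {y : 𝔼 n | y ≠ 0}) :=
  e.open_target.prod isOpen_ne

variable [IsManifold (𝓡 n) ∞ M]

lemma contMDiffOn_tangentMapWithin_symm :
    ContMDiffOn 𝓘(ℝ, (𝔼 n) × 𝔼 n) (𝓡 n).tangent ∞
      (fun z : 𝔼 n × 𝔼 n => tangentMapWithin (𝓡 n) (𝓡 n) e.symm e.target ⟨z.1, z.2⟩)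
      (e.target ×ˢ univ) := by
  have h1 := (contMDiffOn_symm_of_mem_maximalAtlas he).contMDiffOn_tangentMapWithin
    (m := ∞) (by simp) e.open_target.uniqueMDiffOn
  exact h1.comp contMDiff_tangentBundle_mk.contMDiffOn fun z hz => hz.1

lemma contDiffOn_sqInChart {F : TangentBundle (𝓡 n) M → ℝ} (hF : IsFinslerMetric F) :
    ContDiffOn ℝ ∞ (sqInChart F e) (e.target ×ˢ {y : 𝔼 n | y ≠ 0}) := by
  have h3 : ContMDiffOn 𝓘(ℝ, (𝔼 n) × 𝔼 n) 𝓘(ℝ, ℝ) ∞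
      (F ∘ fun z : 𝔼 n × 𝔼 n => tangentMapWithin (𝓡 n) (𝓡 n) e.symm e.target ⟨z.1, z.2⟩)
      (e.target ×ˢ {y : 𝔼 n | y ≠ 0}) := by
    refine hF.smooth.comp ((contMDiffOn_tangentMapWithin_symm he).mono
      (prod_mono_right (subset_univ _))) fun z hz => ?_
    change mfderivWithin (𝓡 n) (𝓡 n) e.symm e.target z.1 z.2 ≠ 0
    rw [mfderivWithin_of_isOpen e.open_target hz.1, mfderiv_symm_eq_ofCoords he hz.1]
    exact ofCoords_ne_zero he (e.map_target hz.1) hz.2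
  refine (h3.contDiffOn.pow 2).congr fun z hz => ?_
  have : tangentMapWithin (𝓡 n) (𝓡 n) e.symm e.target ⟨z.1, z.2⟩
      = tangentMap (𝓡 n) (𝓡 n) e.symm ⟨z.1, z.2⟩ :=
    tangentMapWithin_eq_tangentMap (e.open_target.uniqueMDiffOn z.1 hz.1)
      ((mdifferentiable_of_mem_maximalAtlas he).mdifferentiableAt_symm hz.1)
  rw [sqInChart, ← this]
  rfl

lemma contDiffOn_vectorField_coords {Y : (x : M) → TangentSpace (𝓡 n) x}
    (hY : ContMDiff (𝓡 n) (𝓡 n).tangent ∞ fun x => (⟨x, Y x⟩ : TangentBundle (𝓡 n) M)) :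
    ContDiffOn ℝ ∞ (fun x => coords e (e.symm x) (Y (e.symm x))) e.target := by
  have h1 := (contMDiffOn_of_mem_maximalAtlas he).contMDiffOn_tangentMapWithin
    (m := ∞) (by simp) e.open_source.uniqueMDiffOn
  have h2 := (contMDiff_snd_tangentBundle_modelSpace (𝔼 n) (𝓡 n) (n := ∞)).comp_contMDiffOn
    (h1.comp (hY.comp_contMDiffOn (contMDiffOn_symm_of_mem_maximalAtlas he))
      fun x hx => e.map_target hx)
  refine h2.contDiffOn.congr fun x hx => ?_
  change coords e (e.symm x) (Y (e.symm x))
    = mfderivWithin (𝓡 n) (𝓡 n) e e.source (e.symm x) (Y (e.symm x))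
  rw [mfderivWithin_of_isOpen e.open_source (e.map_target hx)]
  rfl

lemma sum_dy_sqInChart_mul {F : TangentBundle (𝓡 n) M → ℝ} (hF : IsFinslerMetric F) :
    ∀ z ∈ e.target ×ˢ {y : 𝔼 n | y ≠ 0},
      ∑ l, dy l (sqInChart F e) z * z.2 l = 2 * sqInChart F e z := by
  intro z hz
  refine sum_dy_mul (isOpen_slit e) (contDiffOn_sqInChart he hF) (fun z hz c hc => ?_) hz
  rw [sqInChart_eq he F hz.1, map_smul, hF.homogeneous _ _ c hc.le, mul_pow,
    ← sqInChart_eq he F hz.1]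

lemma fundamentalTensor_eq {F : TangentBundle (𝓡 n) M → ℝ} (hF : IsFinslerMetric F) {x : 𝔼 n}
    (hx : x ∈ e.target) {y : TangentSpace (𝓡 n) (e.symm x)} (hy : y ≠ 0)
    (u v : TangentSpace (𝓡 n) (e.symm x)) :
    fundamentalTensor F (e.symm x) y u v =
      ∑ i, ∑ j, lagrangianHessian (sqInChart F e) (x, coords e (e.symm x) y) i j
        * coords e (e.symm x) u i * coords e (e.symm x) v j := by
  have hq := e.map_target hx
  have h := deriv_deriv_fibre (isOpen_slit e) (contDiffOn_sqInChart he hF)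
    (x := x) (y := coords e (e.symm x) y) ⟨hx, coords_ne_zero he hq hy⟩ (coords e (e.symm x) u)
    (coords e (e.symm x) v)
  simp only [sqInChart_eq he F hx, map_add, map_smul, ofCoords_coords he hq] at h
  rw [fundamentalTensor, h]
  simp only [Finset.mul_sum, lagrangianHessian, Matrix.of_apply, mul_assoc]

lemma isUnit_det_lagrangianHessian {F : TangentBundle (𝓡 n) M → ℝ} (hF : IsFinslerMetric F) :
    ∀ z ∈ e.target ×ˢ {y : 𝔼 n | y ≠ 0},
      IsUnit (lagrangianHessian (sqInChart F e) z).det := by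
  rintro ⟨x, y⟩ ⟨hx, hy⟩
  have hq := e.map_target hx
  refine isUnit_det_of_pos fun v hv => ?_
  have hv' : WithLp.toLp 2 v ≠ (0 : 𝔼 n) := by simpa using hv
  have h := hF.posDef _ _ (ofCoords_ne_zero he hq hy) _ (ofCoords_ne_zero he hq hv')
  rw [fundamentalTensor_eq he hF hx (ofCoords_ne_zero he hq hy)] at h
  simpa only [coords_ofCoords he hq] using h

end Charts

/-! ### Localization along a vector field in a chart -/

section Localization

variable {M : Type*} [TopologicalSpace M] [ChartedSpace (EuclideanSpace ℝ (Fin n)) M]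
  {e : OpenPartialHomeomorph M (EuclideanSpace ℝ (Fin n))}
  {F : TangentBundle (𝓡 n) M → ℝ} {Y : (x : M) → TangentSpace (𝓡 n) x}

/-- The coordinate expression of a vector field. -/
def coordField (e : OpenPartialHomeomorph M (EuclideanSpace ℝ (Fin n)))
    (Y : (x : M) → TangentSpace (𝓡 n) x) (x : 𝔼 n) : 𝔼 n :=
  coords e (e.symm x) (Y (e.symm x))

/-- The coordinate domain on which a vector field does not vanish. -/
def fieldDomain (e : OpenPartialHomeomorph M (EuclideanSpace ℝ (Fin n)))
    (Y : (x : M) → TangentSpace (𝓡 n) x) : Set (𝔼 n) :=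
  e.target ∩ coordField e Y ⁻¹' {y | y ≠ 0}

lemma coordField_apply {q : M} (hq : q ∈ e.source) : coordField e Y (e q) = coords e q (Y q) := by
  rw [coordField, e.left_inv hq]

variable [IsManifold (𝓡 n) ∞ M] (he : e ∈ IsManifold.maximalAtlas (𝓡 n) ∞ M)

include he

lemma isOpen_fieldDomain
    (hY : ContMDiff (𝓡 n) (𝓡 n).tangent ∞ fun x => (⟨x, Y x⟩ : TangentBundle (𝓡 n) M)) :
    IsOpen (fieldDomain e Y) :=
  (contDiffOn_vectorField_coords he hY).continuousOn.isOpen_inter_preimage e.open_target isOpen_ne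

omit he [IsManifold (𝓡 n) ∞ M] in
lemma field_ne_zero {x : 𝔼 n} (hx : x ∈ fieldDomain e Y) : Y (e.symm x) ≠ 0 := fun h =>
  hx.2 (by rw [coordField, h, map_zero])

lemma localization_eq (hF : IsFinslerMetric F) {x : 𝔼 n} (hx : x ∈ fieldDomain e Y)
    (u v : TangentSpace (𝓡 n) (e.symm x)) :
    localization F Y (e.symm x) u v =
      ∑ i, ∑ j, localizedHessian (sqInChart F e) (coordField e Y) x i j
        * coords e (e.symm x) u i * coords e (e.symm x) v j :=
  fundamentalTensor_eq he hF hx.1 (field_ne_zero hx) u v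

lemma metricMatrix_localization (hF : IsFinslerMetric F) :
    EqOn (metricMatrix (localization F Y) e)
      (localizedHessian (sqInChart F e) (coordField e Y)) (fieldDomain e Y) := by
  intro x hx
  ext i j
  rw [metricMatrix, Matrix.of_apply, mfderiv_symm_eq_ofCoords he hx.1,
    mfderiv_symm_eq_ofCoords he hx.1, localization_eq he hF hx,
    coords_ofCoords he (e.map_target hx.1), coords_ofCoords he (e.map_target hx.1)]
  simp

lemma sqInChart_localization (hF : IsFinslerMetric F) :
    EqOn (sqInChart (riemannianNorm (localization F Y)) e)
      (quadraticLagrangian (localizedHessian (sqInChart F e) (coordField e Y)))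
      (fieldDomain e Y ×ˢ univ) := by
  rintro ⟨x, y⟩ ⟨hx, -⟩
  have hq := e.map_target hx.1
  have h1 : localization F Y (e.symm x) (ofCoords e (e.symm x) y) (ofCoords e (e.symm x) y)
      = quadraticLagrangian (localizedHessian (sqInChart F e) (coordField e Y)) (x, y) := by
    rw [localization_eq he hF hx, coords_ofCoords he hq, quadraticLagrangian]
    simp only [Finset.sum_mul]
    exact Finset.sum_congr rfl fun _ _ => Finset.sum_congr rfl fun _ _ => by ring
  -- Needed to cancel the square root. Positive definiteness covers nonzero vectors; the zero vector
  -- is treated separately.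
  have h2 : 0 ≤ localization F Y (e.symm x) (ofCoords e (e.symm x) y)
      (ofCoords e (e.symm x) y) := by
    by_cases hy : y = 0
    · rw [h1, hy]
      simp [quadraticLagrangian]
    · exact (hF.posDef _ _ (field_ne_zero hx) _ (ofCoords_ne_zero he hq hy)).le
  rw [sqInChart_eq he _ hx.1, riemannianNorm, Real.sq_sqrt h2, h1]

/-- An integral curve of `Y` through `p` that is a geodesic, in coordinates. -/
lemma exists_geodesic_coords
    (hY : ContMDiff (𝓡 n) (𝓡 n).tangent ∞ fun x => (⟨x, Y x⟩ : TangentBundle (𝓡 n) M))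
    {p : M} (hp : Y p ≠ 0) (hpe : p ∈ e.source) (hgeo : GeneratesGeodesicThrough F Y p) :
    ∃ c : ℝ → 𝔼 n, c 0 = e p ∧ ∀ᶠ t in nhds (0 : ℝ), c t ∈ fieldDomain e Y ∧
      HasDerivAt c (coordField e Y (c t)) t ∧
      ∀ i, geodesicDefect (lagrangianSpray (sqInChart F e)) (coordField e Y) i (c t) = 0 := by
  obtain ⟨γ, ε, hε, h0, hint, -, hgeod⟩ := hgeo
  have hI : Ioo (-ε) ε ∈ nhds (0 : ℝ) := Ioo_mem_nhds (by linarith) hε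
  have hγ : ∀ t ∈ Ioo (-ε) ε, HasMFDerivAt 𝓘(ℝ, ℝ) (𝓡 n) γ t
      ((1 : ℝ →L[ℝ] ℝ).smulRight (Y (γ t))) := fun t ht =>
    (hint t ht).hasMFDerivAt (isOpen_Ioo.mem_nhds ht)
  have hsrc : ∀ᶠ t in nhds (0 : ℝ), γ t ∈ e.source :=
    (hγ 0 (mem_of_mem_nhds hI)).continuousAt.preimage_mem_nhds
      (e.open_source.mem_nhds (by rwa [h0]))
  have hder : ∀ t ∈ Ioo (-ε) ε, γ t ∈ e.source →
      HasDerivAt (fun τ => e (γ τ)) (coordField e Y (e (γ t))) t := by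
    intro t ht hs
    have h1 := ((mdifferentiable_of_mem_maximalAtlas he).mdifferentiableAt hs).hasMFDerivAt.comp t
      (hγ t ht)
    have hcomp : ∀ (A : (𝔼 n) →L[ℝ] 𝔼 n) (y : 𝔼 n),
        HasFDerivAt (fun τ => e (γ τ)) (A.comp ((1 : ℝ →L[ℝ] ℝ).smulRight y)) t →
        HasDerivAt (fun τ => e (γ τ)) (A y) t := fun A y h => by simpa using h.hasDerivAt
    rw [coordField_apply hs]
    exact hcomp _ _ h1.hasFDerivAt
  have hc0 : e (γ 0) = e p := by rw [h0]
  have hdom : ∀ᶠ t in nhds (0 : ℝ), e (γ t) ∈ fieldDomain e Y := by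
    refine (hder 0 (mem_of_mem_nhds hI) (by rwa [h0])).continuousAt.preimage_mem_nhds
      ((isOpen_fieldDomain he hY).mem_nhds ?_)
    rw [hc0]
    refine ⟨e.map_source hpe, ?_⟩
    change coordField e Y (e p) ≠ 0
    rw [coordField_apply hpe]
    exact coords_ne_zero he hpe hp
  refine ⟨fun τ => e (γ τ), hc0, ?_⟩
  -- The second derivative at `t` requires `ċ = V ∘ c` on a neighbourhood of `t`, not just at `t`;
  -- the `eventually_nhds` facts provide it.
  filter_upwards [hI, hsrc, hdom, (Filter.eventually_mem_set.2 hI).eventually_nhds,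
    hsrc.eventually_nhds] with t ht hs hd hI' hs'
  refine ⟨hd, hder t ht hs, fun i => ?_⟩
  have h1 := (hgeod e he t ht hs).2 i
  have h2 : (deriv fun τ => e (γ τ) i) =ᶠ[nhds t] fun τ => coordField e Y (e (γ τ)) i := by
    filter_upwards [hI', hs'] with τ hτ hτs
    exact ((EuclideanSpace.proj (𝕜 := ℝ) i).hasFDerivAt.comp_hasDerivAt τ (hder τ hτ hτs)).deriv
  have hV : ContDiffOn ℝ ∞ (fun x => coordField e Y x i) e.target :=
    (EuclideanSpace.proj (𝕜 := ℝ) i).contDiff.comp_contDiffOn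
      (contDiffOn_vectorField_coords he hY)
  have h3 := deriv_comp_eq_sum_pd (differentiableAt_of_contDiffOn e.open_target hV hd.1)
    (hder t ht hs)
  rw [h2.deriv_eq, h3.deriv, (hder t ht hs).deriv] at h1
  exact h1

/-- The Riemann curvatures of `F` and of its localization along `Y` have equal components. -/
theorem riemannCoeff_localization (hF : IsFinslerMetric F)
    (hY : ContMDiff (𝓡 n) (𝓡 n).tangent ∞ fun x => (⟨x, Y x⟩ : TangentBundle (𝓡 n) M))
    {p : M} (hp : Y p ≠ 0) (hpe : p ∈ e.source) (hgeo : GeneratesGeodesicThrough F Y p) :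
    riemannCoeff F e (e p, coords e p (Y p))
      = riemannCoeff (riemannianNorm (localization F Y)) e (e p, coords e p (Y p)) := by
  obtain ⟨c, hc0, hc⟩ := exists_geodesic_coords he hY hp hpe hgeo
  have hU := isOpen_fieldDomain he hY
  have h := sprayRiemann_localized (isOpen_slit e) (contDiffOn_sqInChart he hF)
    (sum_dy_sqInChart_mul he hF) hU
    ((contDiffOn_vectorField_coords he hY).mono inter_subset_left) (fun x hx => hx)
    (isUnit_det_lagrangianHessian he hF) hc
  have h0 := hc.self_of_nhds.1
  rw [hc0] at h h0
  rw [← coordField_apply hpe]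
  have hΩ : IsOpen (fieldDomain e Y ×ˢ (univ : Set (𝔼 n))) := hU.prod isOpen_univ
  exact h.trans (sprayRiemann_congr hΩ
    (fun i => (lagrangianSpray_congr hΩ (sqInChart_localization he hF) i).symm) ⟨h0, trivial⟩)

end Localization

/-! ### Sectional curvature in terms of components -/

section Sectional

/-- An alternating bilinear form restricted to a plane scales by the determinant. -/
lemma sum_sum_antisymm {a : Fin n → Fin n → ℝ} (ha : ∀ i j, a i j = -a j i) (y v : 𝔼 n)
    (α β γ δ : ℝ) :
    ∑ i, ∑ j, a i j * (α • y + β • v) i * (γ • y + δ • v) j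
      = (α * δ - β * γ) * ∑ i, ∑ j, a i j * y i * v j := by
  have hsw : ∀ u w : 𝔼 n, ∑ i, ∑ j, a i j * u i * w j = -∑ i, ∑ j, a i j * w i * u j := by
    intro u w
    rw [Finset.sum_comm]
    simp only [← Finset.sum_neg_distrib]
    refine Finset.sum_congr rfl fun i _ => Finset.sum_congr rfl fun j _ => ?_
    rw [ha j i]
    ring
  have h0 : ∀ u : 𝔼 n, ∑ i, ∑ j, a i j * u i * u j = 0 := fun u => by linarith [hsw u u]
  calc _ = α * γ * ∑ i, ∑ j, a i j * y i * y j + α * δ * ∑ i, ∑ j, a i j * y i * v j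
        + β * γ * ∑ i, ∑ j, a i j * v i * y j + β * δ * ∑ i, ∑ j, a i j * v i * v j := by
        simp only [Finset.mul_sum, ← Finset.sum_add_distrib]
        refine Finset.sum_congr rfl fun i _ => Finset.sum_congr rfl fun j _ => ?_
        simp only [PiLp.add_apply, PiLp.smul_apply, smul_eq_mul]
        ring
    _ = _ := by rw [h0, h0, hsw v y]; ring

/-- The quadrilinear expression `g(R(u, w) w, u)` for lowered curvature components `r l i j k`. -/
def curvatureForm (r : Fin n → Fin n → Fin n → Fin n → ℝ) (u w : 𝔼 n) : ℝ :=
  ∑ i, ∑ j, (∑ k, ∑ l, r l i j k * w k * u l) * u i * w j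

/-- Each antisymmetric index pair contributes one factor of the determinant. -/
lemma curvatureForm_change {r : Fin n → Fin n → Fin n → Fin n → ℝ}
    (h1 : ∀ l i j k, r l i j k = -r l j i k) (h2 : ∀ l i j k, r l i j k = -r k i j l)
    (y v : 𝔼 n) (α β γ δ : ℝ) :
    curvatureForm r (α • y + β • v) (γ • y + δ • v)
      = (α * δ - β * γ) ^ 2 * curvatureForm r y v := by
  have e1 : ∀ u w : 𝔼 n, ∀ i j, ∑ k, ∑ l, r l i j k * w k * u l
      = -∑ k, ∑ l, r l j i k * w k * u l := by
    intro u w i j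
    simp only [← Finset.sum_neg_distrib]
    refine Finset.sum_congr rfl fun k _ => Finset.sum_congr rfl fun l _ => ?_
    rw [h1 l i j k]
    ring
  have e2 : ∀ i j, ∑ k, ∑ l, r l i j k * (γ • y + δ • v) k * (α • y + β • v) l
      = (α * δ - β * γ) * ∑ k, ∑ l, r l i j k * v k * y l := by
    intro i j
    rw [sum_sum_antisymm (a := fun k l => r l i j k) (fun k l => h2 l i j k)]
    -- The inner form takes its arguments in the opposite order; the coefficients `0, 1, 1, 0`
    -- exchange `y` and `v` and supply the compensating sign.
    have := sum_sum_antisymm (a := fun k l => r l i j k) (fun k l => h2 l i j k) y v 0 1 1 0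
    simp only [zero_smul, one_smul, zero_add, add_zero] at this
    rw [this]
    ring
  rw [curvatureForm, sum_sum_antisymm (e1 _ _), curvatureForm]
  simp only [e2, Finset.mul_sum, Finset.sum_mul]
  refine Finset.sum_congr rfl fun i _ => Finset.sum_congr rfl fun j _ => Finset.sum_congr rfl
    fun k _ => Finset.sum_congr rfl fun l _ => by ring

lemma exists_det_ne_zero_of_span_eq {W : Type*} [AddCommGroup W] [Module ℝ W] {y v u w : W}
    (h : Submodule.span ℝ {u, w} = Submodule.span ℝ {y, v})
    (hfr : Module.finrank ℝ (Submodule.span ℝ {u, w}) = 2) :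
    ∃ α β γ δ : ℝ, u = α • y + β • v ∧ w = γ • y + δ • v ∧ α * δ - β * γ ≠ 0 := by
  have hu : u ∈ Submodule.span ℝ {y, v} := h ▸ Submodule.subset_span (by simp)
  have hw : w ∈ Submodule.span ℝ {y, v} := h ▸ Submodule.subset_span (by simp)
  obtain ⟨α, β, rfl⟩ := Submodule.mem_span_pair.1 hu
  obtain ⟨γ, δ, rfl⟩ := Submodule.mem_span_pair.1 hw
  refine ⟨α, β, γ, δ, rfl, rfl, fun hD => ?_⟩
  have hli : LinearIndependent ℝ ![α • y + β • v, γ • y + δ • v] := by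
    have hr : range ![α • y + β • v, γ • y + δ • v] = {α • y + β • v, γ • y + δ • v} :=
      Matrix.range_cons_cons_empty _ _ _
    rw [linearIndependent_iff_card_eq_finrank_span, Set.finrank, hr, hfr, Fintype.card_fin]
  -- With zero determinant, Cramer's combinations `δu - βw` and `γu - αw` vanish. Independence then
  -- forces `α = β = 0`, so `u = 0`, a contradiction.
  rw [LinearIndependent.pair_iff] at hli
  have e1 := hli δ (-β) (by
    have : δ • (α • y + β • v) + -β • (γ • y + δ • v) = (α * δ - β * γ) • y := by module
    rw [this, hD, zero_smul])
  have e2 := hli γ (-α) (by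
    have : γ • (α • y + β • v) + -α • (γ • y + δ • v) = -(α * δ - β * γ) • v := by module
    rw [this, hD, neg_zero, zero_smul])
  have hα : α = 0 := by linarith [e2.2]
  have hβ : β = 0 := by linarith [e1.2]
  have := hli 1 0 (by simp [hα, hβ])
  exact one_ne_zero this.1

end Sectional

/-! ### Curvature of the localized metric -/

section LocalizedCurvature

lemma sum_comm_three {ι R : Type*} [Fintype ι] [AddCommMonoid R] (f : ι → ι → ι → R) :
    ∑ a, ∑ b, ∑ c, f a b c = ∑ c, ∑ b, ∑ a, f a b c := by
  rw [Finset.sum_comm]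
  calc _ = ∑ b, ∑ c, ∑ a, f a b c := Finset.sum_congr rfl fun b _ => Finset.sum_comm
    _ = _ := Finset.sum_comm

lemma sum_comm_five {ι R : Type*} [Fintype ι] [AddCommMonoid R]
    (f : ι → ι → ι → ι → ι → R) :
    ∑ a, ∑ b, ∑ i, ∑ j, ∑ k, f a b i j k = ∑ i, ∑ j, ∑ k, ∑ b, ∑ a, f a b i j k := by
  rw [sum_comm_three]
  refine Finset.sum_congr rfl fun i _ => ?_
  rw [sum_comm_three]
  exact Finset.sum_congr rfl fun j _ => sum_comm_three _

variable {M : Type*} [TopologicalSpace M] [ChartedSpace (EuclideanSpace ℝ (Fin n)) M]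
  [IsManifold (𝓡 n) ∞ M]
  {e : OpenPartialHomeomorph M (EuclideanSpace ℝ (Fin n))}
  {F : TangentBundle (𝓡 n) M → ℝ} {Y : (x : M) → TangentSpace (𝓡 n) x}

/-- The lowered curvature components of the localization. -/
def localizedCurvature (F : TangentBundle (𝓡 n) M → ℝ)
    (e : OpenPartialHomeomorph M (EuclideanSpace ℝ (Fin n)))
    (Y : (x : M) → TangentSpace (𝓡 n) x) (x : 𝔼 n) (l i j k : Fin n) : ℝ :=
  ∑ p, localizedHessian (sqInChart F e) (coordField e Y) x l p
    * matrixCurvature (localizedHessian (sqInChart F e) (coordField e Y)) p i j k x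

variable (he : e ∈ IsManifold.maximalAtlas (𝓡 n) ∞ M) (hF : IsFinslerMetric F)
  (hY : ContMDiff (𝓡 n) (𝓡 n).tangent ∞ fun x => (⟨x, Y x⟩ : TangentBundle (𝓡 n) M))

include he hF hY

lemma contDiffOn_localizedHessian_chart (i j : Fin n) :
    ContDiffOn ℝ ∞ (fun x => localizedHessian (sqInChart F e) (coordField e Y) x i j)
      (fieldDomain e Y) :=
  contDiffOn_localizedHessian (isOpen_slit e) (contDiffOn_sqInChart he hF)
    ((contDiffOn_vectorField_coords he hY).mono inter_subset_left) (fun _ hx => hx) i j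

omit hY in
lemma localizedHessian_isSymm_chart :
    ∀ x ∈ fieldDomain e Y, (localizedHessian (sqInChart F e) (coordField e Y) x).IsSymm :=
  localizedHessian_isSymm (isOpen_slit e) (contDiffOn_sqInChart he hF) fun _ hx => hx

omit hY in
lemma isUnit_det_localizedHessian : ∀ x ∈ fieldDomain e Y,
    IsUnit (localizedHessian (sqInChart F e) (coordField e Y) x).det :=
  fun x hx => isUnit_det_lagrangianHessian he hF (x, coordField e Y x) hx

/-- The Riemann curvature of the localization, viewed as a Finsler metric, is `v ↦ R(v, y) y`. -/
lemma riemannCurvature_localization {x : 𝔼 n} (hx : x ∈ fieldDomain e Y)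
    (y v : TangentSpace (𝓡 n) (e.symm x)) :
    riemannCurvature (riemannianNorm (localization F Y)) e (e.symm x) y v
      = curvatureTensor (localization F Y) e (e.symm x) v y y := by
  have hU := isOpen_fieldDomain he hY
  have hΩ : IsOpen (fieldDomain e Y ×ˢ (univ : Set (𝔼 n))) := hU.prod isOpen_univ
  have hcoeff : ∀ a : 𝔼 n, riemannCoeff (riemannianNorm (localization F Y)) e (x, a)
      = sprayRiemann (lagrangianSpray (quadraticLagrangian
          (localizedHessian (sqInChart F e) (coordField e Y)))) (x, a) := fun a =>
    sprayRiemann_congr hΩ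
      (fun i => lagrangianSpray_congr hΩ (sqInChart_localization he hF) i) ⟨hx, trivial⟩
  have hcurv : ∀ l i j k, curvatureCoeff (localization F Y) e l i j k x
      = matrixCurvature (localizedHessian (sqInChart F e) (coordField e Y)) l i j k x :=
    matrixCurvature_congr hU (metricMatrix_localization he hF) hx
  change ofCoords e (e.symm x) _ = ofCoords e (e.symm x) _
  congr 1
  ext l
  simp only [LinearMap.comp_apply, Matrix.toLpLin_apply, e.right_inv hx.1, hcurv, hcoeff,
    Matrix.mulVec, dotProduct, sprayRiemann_quadraticLagrangian hU
      (contDiffOn_localizedHessian_chart he hF hY) (localizedHessian_isSymm_chart he hF)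
      (isUnit_det_localizedHessian he hF) (z := (x, _)) hx, Finset.sum_mul]
  refine Finset.sum_congr rfl fun i _ => Finset.sum_congr rfl fun j _ => Finset.sum_congr rfl
    fun k _ => ?_
  simp only [ContinuousLinearMap.coe_coe]
  ring

lemma localization_curvatureTensor {x : 𝔼 n} (hx : x ∈ fieldDomain e Y)
    (u w : TangentSpace (𝓡 n) (e.symm x)) :
    localization F Y (e.symm x) (curvatureTensor (localization F Y) e (e.symm x) u w w) u
      = curvatureForm (localizedCurvature F e Y x) (coords e (e.symm x) u)
          (coords e (e.symm x) w) := by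
  have hcurv : ∀ l i j k, curvatureCoeff (localization F Y) e l i j k x
      = matrixCurvature (localizedHessian (sqInChart F e) (coordField e Y)) l i j k x :=
    matrixCurvature_congr (isOpen_fieldDomain he hY) (metricMatrix_localization he hF) hx
  rw [localization_eq he hF hx, curvatureTensor, coords_ofCoords he (e.map_target hx.1)]
  simp only [curvatureForm, localizedCurvature, e.right_inv hx.1, hcurv, Finset.mul_sum,
    Finset.sum_mul]
  rw [sum_comm_five]
  refine Finset.sum_congr rfl fun i _ => Finset.sum_congr rfl fun j _ => Finset.sum_congr rfl
    fun k _ => Finset.sum_congr rfl fun l _ => Finset.sum_congr rfl fun p _ => ?_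
  rw [(localizedHessian_isSymm_chart he hF x hx).apply l p]
  ring

omit hY in
lemma localization_lincomb {x : 𝔼 n} (hx : x ∈ fieldDomain e Y)
    (y v : TangentSpace (𝓡 n) (e.symm x)) (α β γ δ : ℝ) :
    localization F Y (e.symm x) (α • y + β • v) (γ • y + δ • v)
      = α * γ * localization F Y (e.symm x) y y
        + (α * δ + β * γ) * localization F Y (e.symm x) y v
        + β * δ * localization F Y (e.symm x) v v := by
  have hsymm : localization F Y (e.symm x) y v = localization F Y (e.symm x) v y := by
    rw [localization_eq he hF hx, localization_eq he hF hx, Finset.sum_comm]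
    refine Finset.sum_congr rfl fun i _ => Finset.sum_congr rfl fun j _ => ?_
    rw [(localizedHessian_isSymm_chart he hF x hx).apply i j]
    ring
  have hexp : localization F Y (e.symm x) (α • y + β • v) (γ • y + δ • v)
      = α * γ * localization F Y (e.symm x) y y + α * δ * localization F Y (e.symm x) y v
        + β * γ * localization F Y (e.symm x) v y + β * δ * localization F Y (e.symm x) v v := by
    simp only [localization_eq he hF hx, Finset.mul_sum, ← Finset.sum_add_distrib, map_add,
      map_smul, PiLp.add_apply, PiLp.smul_apply, smul_eq_mul]
    exact Finset.sum_congr rfl fun _ _ => Finset.sum_congr rfl fun _ _ => by ring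
  rw [hexp, ← hsymm]
  ring

/-- `g(R(u, w) w, u)` scales by the squared determinant under a change of basis. -/
lemma localization_curvatureTensor_lincomb {x : 𝔼 n} (hx : x ∈ fieldDomain e Y)
    (y v : TangentSpace (𝓡 n) (e.symm x)) (α β γ δ : ℝ) :
    localization F Y (e.symm x) (curvatureTensor (localization F Y) e (e.symm x)
        (α • y + β • v) (γ • y + δ • v) (γ • y + δ • v)) (α • y + β • v)
      = (α * δ - β * γ) ^ 2 * localization F Y (e.symm x)
          (curvatureTensor (localization F Y) e (e.symm x) y v v) y := by
  rw [localization_curvatureTensor he hF hY hx, localization_curvatureTensor he hF hY hx]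
  simp only [map_add, map_smul]
  refine curvatureForm_change (fun l i j k => ?_) (fun l i j k => ?_) _ _ α β γ δ
  · simp only [localizedCurvature, ← Finset.sum_neg_distrib]
    exact Finset.sum_congr rfl fun p _ => by rw [matrixCurvature_swap p i j k]; ring
  · exact sum_mul_matrixCurvature_swap (isOpen_fieldDomain he hY)
      (contDiffOn_localizedHessian_chart he hF hY) (localizedHessian_isSymm_chart he hF)
      (isUnit_det_localizedHessian he hF) hx l i j k

/-- The sectional curvature of the localization does not depend on the basis of the plane, and is
given by the Riemann curvature of the localization. -/
lemma sectionalCurvature_localization {x : 𝔼 n} (hx : x ∈ fieldDomain e Y)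
    {y v u w : TangentSpace (𝓡 n) (e.symm x)}
    (hspan : Submodule.span ℝ {u, w} = Submodule.span ℝ {y, v})
    (hfr : Module.finrank ℝ (Submodule.span ℝ {u, w}) = 2) :
    sectionalCurvature (localization F Y) e (e.symm x) u w
      = localization F Y (e.symm x)
          (riemannCurvature (riemannianNorm (localization F Y)) e (e.symm x) y v) v
        / (localization F Y (e.symm x) y y * localization F Y (e.symm x) v v
          - localization F Y (e.symm x) y v ^ 2) := by
  obtain ⟨α, β, γ, δ, rfl, rfl, hD⟩ := exists_det_ne_zero_of_span_eq hspan hfr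
  -- Exchanging `y` and `v` has squared determinant 1, which relates `g(R(v, y) y, v)` from the flag
  -- curvature to `g(R(y, v) v, y)`.
  have hsw := localization_curvatureTensor_lincomb he hF hY hx y v 0 1 1 0
  simp only [zero_smul, one_smul, zero_add, add_zero] at hsw
  rw [sectionalCurvature, localization_curvatureTensor_lincomb he hF hY hx,
    riemannCurvature_localization he hF hY hx, hsw, localization_lincomb he hF hx,
    localization_lincomb he hF hx, localization_lincomb he hF hx]
  have hD2 : (α * δ - β * γ) ^ 2 ≠ 0 := pow_ne_zero 2 hD
  -- The Gram determinant scales by the same squared determinant, which therefore cancels.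
  rw [← mul_div_mul_left _ (localization F Y (e.symm x) y y * localization F Y (e.symm x) v v
    - localization F Y (e.symm x) y v ^ 2) hD2]
  congr 1
  · ring
  · ring

end LocalizedCurvature

end Finsler

end

/-! ### Conclusion in an arbitrary chart of the maximal atlas around `p` -/

theorem mainTheorem7 {n : ℕ} {M : Type*} [TopologicalSpace M]
    [ChartedSpace (EuclideanSpace ℝ (Fin n)) M] [IsManifold (𝓡 n) ∞ M]
    (F : TangentBundle (𝓡 n) M → ℝ) (hF : Finsler.IsFinslerMetric F)
    (Y : (x : M) → TangentSpace (𝓡 n) x)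
    (hY : ContMDiff (𝓡 n) (𝓡 n).tangent ∞ fun x => (⟨x, Y x⟩ : TangentBundle (𝓡 n) M))
    (p : M) (hp : Y p ≠ 0) (hgeo : Finsler.GeneratesGeodesicThrough F Y p)
    (e : OpenPartialHomeomorph M (EuclideanSpace ℝ (Fin n)))
    (he : e ∈ IsManifold.maximalAtlas (𝓡 n) ∞ M) (hpe : p ∈ e.source) :
    Finsler.riemannCurvature F e p (Y p) =
        Finsler.riemannCurvature (Finsler.riemannianNorm (Finsler.localization F Y)) e p (Y p) ∧
      ∀ P : Submodule ℝ (TangentSpace (𝓡 n) p), Module.finrank ℝ P = 2 → Y p ∈ P →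
        ∀ v u w : TangentSpace (𝓡 n) p,
          Submodule.span ℝ {Y p, v} = P → Submodule.span ℝ {u, w} = P →
            Finsler.flagCurvature F e p (Y p) v =
              Finsler.sectionalCurvature (Finsler.localization F Y) e p u w := by
  have hR : Finsler.riemannCurvature F e p (Y p) =
      Finsler.riemannCurvature (Finsler.riemannianNorm (Finsler.localization F Y)) e p (Y p) := by
    rw [Finsler.riemannCurvature, Finsler.riemannCurvature,
      Finsler.riemannCoeff_localization he hF hY hp hpe hgeo]
  refine ⟨hR, fun P hP _ v u w hv hu => ?_⟩
  -- The inner product in the flag curvature is already `g_Y` at `p`, by definition of the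
  -- localization, so only the curvature operator has to be replaced.
  rw [Finsler.flagCurvature, hR]
  obtain ⟨x, hx, rfl⟩ : ∃ x ∈ e.target, e.symm x = p :=
    ⟨e p, e.map_source hpe, e.left_inv hpe⟩
  subst hu
  exact (Finsler.sectionalCurvature_localization he hF hY
    ⟨hx, Finsler.coords_ne_zero he hpe hp⟩ hv.symm hP).symm
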